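/- Let $G$ be a finite connected split graph on $n$ vertices, with vertex set partitioned into an independent set $S$ (its elements are called cone vertices) and a clique $K$. Let $r\in S$ have eccentricity $\mathrm{ecc}(r)=\max_v \mathrm{dist}(v,r)=3$. A configuration is a function $C:V(G)\to\mathbb{N}$, of size $|C|=\sum_v C(v)$. A pebbling step along an edge $uv$ removes two pebbles from $u$ and adds one pebble at $v$. $C$ is $r$-solvable if some sequence of pebbling steps starting at $C$ puts a pebble on $r$ (an $r$-solution); the solution is semigreedy if every step from $u$ to $v$ in it satisfies $\mathrm{dist}(v,r)\le\mathrm{dist}(u,r)$. Let $\pi(G,r)$ be the least $t$ such that every configuration of size at least $t$ is $r$-solvable. $G$ is $r$-semigreedy if every configuration of size at least $\pi(G,r)$ has a semigreedy $r$-solution. Write $d_x$ and $N_x$ for the degree and the neighborhood of $x$. Let $\delta_s(G,r)$ be the minimum degree among all vertices at maximum distance from $r$, and let $s$ be any vertex with $\mathrm{dist}(r,s)=3$ and $d_s=\delta_s(G,r)$. Let $c_{rs}$ be the number of cut vertices of $G$ in $K\setminus(N_r\cup N_s)$, and let $c_{r,0}$ be the number of cut vertices of $G$ in $N_r$ that are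 adjacent to some cone vertex other than $r$. Put $$t(G,r)=\max\{\,n+c_{rs}+6-d_r-d_s,\;\; n+c_{rs}+2-d_r,\;\; n+c_{rs}+c_{r,0}+2-d_s,\;\; n+c_{rs}+c_{r,0}\,\}.$$ $G$ is $r$-Pereyra if there are cone vertices $p,q$ and distinct vertices $a,b,c$ with $N_r=\{a,b\}$, $N_p=\{a,c\}$, $N_q=\{b,c\}$ such that none of $r,p,q,a,b,c$ is a cut vertex of $G$. $G$ is $r$-Phoenix if it is $r$-Pereyra, $\mathrm{ecc}(r)=3$ and $\delta_s(G,r)\ge 4$. Let $\phi(G,r)=1$ if $G$ is $r$-Phoenix and $\phi(G,r)=0$ otherwise. Then $G$ is $r$-semigreedy, and $\pi(G,r)=t(G,r)+\phi(G,r)$ (for every such choice of $s$). -/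

import Mathlib

namespace SplitPebbling

variable {V : Type*}

/-- The vertex set of `G` is partitioned into an independent set `S` (whose elements are the
cone vertices) and a clique `K`. -/
structure IsSplitPartition (G : SimpleGraph V) (S K : Set V) : Prop where
  indep : G.IsIndepSet S
  clique : G.IsClique K
  disj : Disjoint S K
  cover : S ∪ K = Set.univ

/-- A cut vertex of a connected graph: deleting it leaves a graph that is not connected. -/
def IsCutVertex (G : SimpleGraph V) (v : V) : Prop :=
  ¬ (G.induce {w | w ≠ v}).Preconnected

section Pebbling

variable [DecidableEq V]

/-- A pebbling step along the edge `uv` turns the configuration `C` into `C'`: two pebbles are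
removed from `u` and one pebble is added at `v`. -/
def Step (G : SimpleGraph V) (u v : V) (C C' : V → ℕ) : Prop :=
  G.Adj u v ∧ 2 ≤ C u ∧ C' = Function.update (Function.update C u (C u - 2)) v (C v + 1)

/-- Some sequence of pebbling steps starting at `C` puts a pebble on `r`. -/
def Solvable (G : SimpleGraph V) (r : V) (C : V → ℕ) : Prop :=
  ∃ C' : V → ℕ,
    Relation.ReflTransGen (fun D D' : V → ℕ => ∃ u v : V, Step G u v D D') C C' ∧ 1 ≤ C' r

/-- Some sequence of pebbling steps starting at `C`, none of which increases the distance of the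
moved pebble to `r`, puts a pebble on `r`. -/
def SemigreedySolvable (G : SimpleGraph V) (r : V) (C : V → ℕ) : Prop :=
  ∃ C' : V → ℕ,
    Relation.ReflTransGen
      (fun D D' : V → ℕ => ∃ u v : V, Step G u v D D' ∧ G.dist v r ≤ G.dist u r) C C' ∧ 1 ≤ C' r

/-- `π(G, r)`: the least `t` such that every configuration of size at least `t` is
`r`-solvable. -/
noncomputable def pebblingNumber [Fintype V] (G : SimpleGraph V) (r : V) : ℕ :=
  sInf {t : ℕ | ∀ C : V → ℕ, t ≤ ∑ v, C v → Solvable G r C}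

/-- `G` is `r`-semigreedy. -/
def IsSemigreedy [Fintype V] (G : SimpleGraph V) (r : V) : Prop :=
  ∀ C : V → ℕ, pebblingNumber G r ≤ ∑ v, C v → SemigreedySolvable G r C

end Pebbling

section Parameters

variable [Fintype V]

/-- `δ_s(G, r)`: the minimum degree among all vertices at maximum distance from `r`. -/
noncomputable def farMinDegree (G : SimpleGraph V) [DecidableRel G.Adj] (r : V) : ℕ :=
  sInf {d : ℕ | ∃ v : V, G.edist r v = G.eccent r ∧ G.degree v = d}

/-- `G` has an `r`-Pyramid none of whose vertices is a cut vertex: there are cone vertices `p`, `q`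
such that the neighborhoods of `r`, `p`, `q` are the three edges of a triangle `a b c`, and
none of the six vertices is a cut vertex of `G`. -/
def IsPereyra (G : SimpleGraph V) (S : Set V) (r : V) : Prop :=
  ∃ p ∈ S, ∃ q ∈ S, ∃ a b c : V, r ∈ S ∧ a ≠ b ∧ a ≠ c ∧ b ≠ c ∧
    G.neighborSet r = {a, b} ∧ G.neighborSet p = {a, c} ∧ G.neighborSet q = {b, c} ∧
    ∀ x ∈ ({r, p, q, a, b, c} : Set V), ¬ IsCutVertex G x

/-- `G` is `r`-Phoenix. -/
def IsPhoenix (G : SimpleGraph V) [DecidableRel G.Adj] (S : Set V) (r : V) : Prop :=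
  IsPereyra G S r ∧ G.eccent r = 3 ∧ 4 ≤ farMinDegree G r

open Classical in
/-- `φ(G, r)`: the indicator of being `r`-Phoenix. -/
noncomputable def phoenixIndicator (G : SimpleGraph V) [DecidableRel G.Adj] (S : Set V) (r : V) :
    ℤ :=
  if IsPhoenix G S r then 1 else 0

/-- The number of cut vertices in `K` adjacent to neither `r` nor `s`. -/
noncomputable def cutRS (G : SimpleGraph V) (K : Set V) (r s : V) : ℤ :=
  ({x : V | x ∈ K ∧ IsCutVertex G x ∧ ¬ G.Adj r x ∧ ¬ G.Adj s x}.ncard : ℤ)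

/-- The number of cut vertices that are neighbors of `r` and are adjacent to some cone vertex
other than `r`. -/
noncomputable def cutR0 (G : SimpleGraph V) (S : Set V) (r : V) : ℤ :=
  ({x : V | IsCutVertex G x ∧ G.Adj r x ∧ ∃ v ∈ S, v ≠ r ∧ G.Adj v x}.ncard : ℤ)

variable (G : SimpleGraph V) [DecidableRel G.Adj] (S K : Set V) (r s : V)

noncomputable def tRS : ℤ :=
  Fintype.card V + cutRS G K r s + 6 - G.degree r - G.degree s

noncomputable def tR : ℤ :=
  Fintype.card V + cutRS G K r s + 2 - G.degree r

noncomputable def tS : ℤ :=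
  Fintype.card V + cutRS G K r s + cutR0 G S r + 2 - G.degree s

noncomputable def tZero : ℤ :=
  Fintype.card V + cutRS G K r s + cutR0 G S r

/-- `t(G, r)`, computed with a vertex `s` of minimum degree among those at distance `3`
from `r`. -/
noncomputable def tMax : ℤ :=
  max (max (tRS G K r s) (tR G K r s)) (max (tS G S K r s) (tZero G S K r s))

end Parameters

end SplitPebbling

namespace SplitPebbling

variable {V : Type*}

/-- `G` is a connected split graph and `r` is a cone vertex of eccentricity three. -/
structure IsDeepRoot (G : SimpleGraph V) (S K : Set V) (r : V) : Prop where
  conn : G.Connected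
  split : IsSplitPartition G S K
  mem : r ∈ S
  ecc : G.eccent r = 3

/-- `v` is a cone vertex, other than `r`, which has no common neighbor with `r`. -/
def IsFar (G : SimpleGraph V) (S : Set V) (r v : V) : Prop :=
  v ∈ S ∧ v ≠ r ∧ ∀ x, G.Adj v x → ¬ G.Adj r x

/-- `x` is the only neighbor of some cone vertex other than `r`. -/
def HasLeaf (G : SimpleGraph V) (S : Set V) (r x : V) : Prop :=
  ∃ l ∈ S, l ≠ r ∧ G.neighborSet l = {x}

section Structure

variable {G : SimpleGraph V} {S K : Set V} {r : V}

theorem IsSplitPartition.not_mem_right (h : IsSplitPartition G S K) {v : V} (hv : v ∈ S) :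
    v ∉ K := fun hk => Set.disjoint_left.1 h.disj hv hk

theorem IsSplitPartition.mem_or (h : IsSplitPartition G S K) (v : V) : v ∈ S ∨ v ∈ K := by
  have : v ∈ S ∪ K := h.cover ▸ Set.mem_univ v
  exact this

theorem IsSplitPartition.mem_of_adj (h : IsSplitPartition G S K) {v x : V} (hv : v ∈ S)
    (hx : G.Adj v x) : x ∈ K :=
  (h.mem_or x).resolve_left fun hs => h.indep hv hs hx.ne hx

theorem IsSplitPartition.adj (h : IsSplitPartition G S K) {x y : V} (hx : x ∈ K) (hy : y ∈ K)
    (hxy : x ≠ y) : G.Adj x y := h.clique hx hy hxy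

theorem IsSplitPartition.ne (h : IsSplitPartition G S K) {x y : V} (hx : x ∈ S) (hy : y ∈ K) :
    x ≠ y := by
  rintro rfl; exact h.not_mem_right hx hy

namespace IsDeepRoot

variable (h : IsDeepRoot G S K r)
include h

theorem nontrivial : Nontrivial V := by
  rw [← G.eccent_pos_iff r, h.ecc]; norm_num

theorem exists_adj (v : V) : ∃ x, G.Adj v x :=
  have := h.nontrivial
  h.conn.preconnected.exists_adj_of_nontrivial v

theorem exists_dist_eq_three [Finite V] : ∃ s, G.dist r s = 3 := by
  obtain ⟨s, hs⟩ := G.exists_edist_eq_eccent_of_finite r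
  refine ⟨s, ?_⟩
  rw [h.ecc, ← (h.conn.preconnected r s).coe_dist_eq_edist] at hs
  exact_mod_cast hs

theorem dist_pos {x : V} (hx : x ≠ r) : 1 ≤ G.dist x r :=
  h.conn.pos_dist_of_ne hx

theorem dist_le_two {x : V} (hx : x ∈ K) : G.dist x r ≤ 2 := by
  obtain ⟨a, ha⟩ := h.exists_adj r
  by_cases hxa : x = a
  · subst hxa; rw [SimpleGraph.dist_eq_one_iff_adj.2 ha.symm]; norm_num
  · have := SimpleGraph.dist_le (SimpleGraph.Walk.cons
      (h.split.adj hx (h.split.mem_of_adj h.mem ha) hxa) (SimpleGraph.Walk.cons ha.symm .nil))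
    simpa using this

theorem two_le_dist {v : V} (hv : v ∈ S) (hvr : v ≠ r) : 2 ≤ G.dist v r :=
  h.conn.one_lt_dist_of_ne_of_not_adj hvr (h.split.indep hv h.mem hvr)

theorem dist_eq_three_iff {v : V} : G.dist r v = 3 ↔ IsFar G S r v := by
  have hle : G.dist r v ≤ 3 := by
    have : G.edist r v ≤ 3 := h.ecc ▸ G.edist_le_eccent
    rw [← (h.conn.preconnected r v).coe_dist_eq_edist] at this
    exact_mod_cast this
  constructor
  · intro hv
    refine ⟨(h.split.mem_or v).resolve_right fun hK => ?_, ?_, fun x hvx hrx => ?_⟩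
    · have := h.dist_le_two hK
      rw [SimpleGraph.dist_comm] at this; omega
    · rintro rfl; simp at hv
    · have := SimpleGraph.dist_le (SimpleGraph.Walk.cons hrx
        (SimpleGraph.Walk.cons hvx.symm .nil))
      simp only [SimpleGraph.Walk.length_cons, SimpleGraph.Walk.length_nil] at this
      omega
  · rintro ⟨hv, hvr, hno⟩
    have h2 := h.two_le_dist hv hvr
    rw [SimpleGraph.dist_comm] at h2
    refine le_antisymm hle ?_
    by_contra hlt
    have h2' : G.edist r v = 2 := by
      rw [← (h.conn.preconnected r v).coe_dist_eq_edist]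
      have : G.dist r v = 2 := by omega
      rw [this]; norm_num
    rw [SimpleGraph.edist_eq_two_iff] at h2'
    obtain ⟨-, -, x, hx⟩ := h2'
    exact hno x (by simpa using hx.2) (by simpa using hx.1)

theorem exists_ne_mem_clique (x : V) [Finite V] : ∃ y ∈ K, y ≠ x := by
  obtain ⟨s, hs⟩ := h.exists_dist_eq_three
  obtain ⟨hsS, -, hno⟩ := h.dist_eq_three_iff.1 hs
  obtain ⟨a, ha⟩ := h.exists_adj r
  obtain ⟨b, hb⟩ := h.exists_adj s
  by_cases hax : a = x
  · refine ⟨b, h.split.mem_of_adj hsS hb, ?_⟩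
    rintro rfl; subst hax; exact hno _ hb ha
  · exact ⟨a, h.split.mem_of_adj h.mem ha, hax⟩

theorem isCutVertex_iff [Finite V] {x : V} :
    IsCutVertex G x ↔ ∃ l ∈ S, G.neighborSet l = {x} := by
  constructor
  · intro hx
    by_contra! hno
    apply hx
    obtain ⟨y, hyK, hyx⟩ := h.exists_ne_mem_clique x
    have key : ∀ w (hw : w ≠ x), (G.induce {w | w ≠ x}).Reachable ⟨w, hw⟩ ⟨y, hyx⟩ := by
      have hK : ∀ w (hw : w ≠ x), w ∈ K →
          (G.induce {w | w ≠ x}).Reachable ⟨w, hw⟩ ⟨y, hyx⟩ := by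
        intro w hw hwK
        by_cases hwy : w = y
        · subst hwy; exact SimpleGraph.Reachable.refl _
        · exact SimpleGraph.Adj.reachable (by simpa using h.split.adj hwK hyK hwy)
      intro w hw
      rcases h.split.mem_or w with hwS | hwK
      · have : ∃ z, G.Adj w z ∧ z ≠ x := by
          by_contra! hz
          apply hno w hwS
          obtain ⟨z, hwz⟩ := h.exists_adj w
          ext u
          simp only [SimpleGraph.mem_neighborSet, Set.mem_singleton_iff]
          refine ⟨hz u, ?_⟩
          rintro rfl; exact hz z hwz ▸ hwz
        obtain ⟨z, hwz, hzx⟩ := this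
        refine SimpleGraph.Reachable.trans (SimpleGraph.Adj.reachable ?_)
          (hK z hzx (h.split.mem_of_adj hwS hwz))
        simpa using hwz
      · exact hK w hw hwK
    rintro ⟨u, hu⟩ ⟨v, hv⟩
    exact (key u hu).trans (key v hv).symm
  · rintro ⟨l, hl, hlx⟩ hpre
    obtain ⟨y, hyK, hyx⟩ := h.exists_ne_mem_clique x
    have hadj : G.Adj l x := by
      rw [← SimpleGraph.mem_neighborSet, hlx]; rfl
    have hne : (⟨l, hadj.ne⟩ : {w | w ≠ x}) ≠ ⟨y, hyx⟩ := by
      intro he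
      exact h.split.ne hl hyK (congrArg Subtype.val he)
    have : Nontrivial {w | w ≠ x} := ⟨⟨_, _, hne⟩⟩
    obtain ⟨⟨z, hz⟩, hlz⟩ := hpre.exists_adj_of_nontrivial ⟨l, hadj.ne⟩
    have : z ∈ G.neighborSet l := by simpa using hlz
    rw [hlx] at this
    exact hz this

theorem not_isCutVertex_of_mem [Finite V] {v : V} (hv : v ∈ S) : ¬ IsCutVertex G v := by
  rw [h.isCutVertex_iff]
  rintro ⟨l, hl, hlv⟩
  have : G.Adj l v := by rw [← SimpleGraph.mem_neighborSet, hlv]; rfl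
  exact h.split.not_mem_right hv (h.split.mem_of_adj hl this)

theorem edist_eq_eccent_iff {v : V} : G.edist r v = G.eccent r ↔ IsFar G S r v := by
  rw [← h.dist_eq_three_iff, h.ecc, ← (h.conn.preconnected r v).coe_dist_eq_edist]
  norm_cast

variable [Fintype V] [DecidableRel G.Adj]

theorem one_le_degree (v : V) : 1 ≤ G.degree v :=
  (G.degree_pos_iff_exists_adj v).2 (h.exists_adj v)

theorem exists_degree_eq_farMinDegree :
    ∃ s, IsFar G S r s ∧ G.degree s = farMinDegree G r := by
  obtain ⟨s, hs⟩ := h.exists_dist_eq_three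
  have := Nat.sInf_mem (s := {d : ℕ | ∃ v : V, G.edist r v = G.eccent r ∧ G.degree v = d})
    ⟨_, s, h.edist_eq_eccent_iff.2 (h.dist_eq_three_iff.1 hs), rfl⟩
  obtain ⟨v, hv, hd⟩ := this
  exact ⟨v, h.edist_eq_eccent_iff.1 hv, hd⟩

theorem farMinDegree_le {v : V} (hv : IsFar G S r v) : farMinDegree G r ≤ G.degree v :=
  Nat.sInf_le ⟨v, h.edist_eq_eccent_iff.2 hv, rfl⟩

end IsDeepRoot

end Structure

section Feeding

variable [DecidableEq V] {G : SimpleGraph V} {r : V}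

/-- The multiset `M` of pebbles suffices to put one pebble on `x` by semigreedy steps. -/
inductive Feeds (G : SimpleGraph V) (r : V) : Multiset V → V → Prop
  | base (x : V) : Feeds G r {x} x
  | step {M N : Multiset V} {u x : V} : Feeds G r M u → Feeds G r N u → G.Adj u x →
      G.dist x r ≤ G.dist u r → Feeds G r (M + N) x

theorem Feeds.reach {M : Multiset V} {x : V} (h : Feeds G r M x) (D : V → ℕ) :
    Relation.ReflTransGen
      (fun D D' : V → ℕ => ∃ u v : V, Step G u v D D' ∧ G.dist v r ≤ G.dist u r)
      (fun y => M.count y + D y) (fun y => (if y = x then 1 else 0) + D y) := by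
  induction h generalizing D with
  | base x =>
    have : (fun y => Multiset.count y {x} + D y) = fun y => (if y = x then 1 else 0) + D y := by
      ext y; simp [Multiset.count_singleton]
    rw [this]
  | @step M N u x _ _ hux hd ihM ihN =>
    have h1 := ihM fun y => N.count y + D y
    have h2 := ihN fun y => (if y = u then 1 else 0) + D y
    have e1 : (fun y => M.count y + (N.count y + D y)) = fun y => (M + N).count y + D y := by
      ext y; rw [Multiset.count_add]; ring
    have e2 : (fun y => (if y = u then 1 else 0) + (N.count y + D y)) =
        fun y => N.count y + ((if y = u then 1 else 0) + D y) := by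
      ext y; ring
    rw [e1, e2] at h1
    refine (h1.trans h2).tail ⟨u, x, ⟨hux, ?_, ?_⟩, hd⟩
    · simp only [if_true]; omega
    · ext y
      by_cases hyx : y = x
      · subst hyx
        have : ¬ y = u := hux.ne'
        simp [this]; ring
      · by_cases hyu : y = u
        · subst hyu; simp [hyx]; omega
        · simp [hyx, hyu]

theorem Feeds.solvable {M : Multiset V} (h : Feeds G r M r) {C : V → ℕ}
    (hC : ∀ y, M.count y ≤ C y) : SemigreedySolvable G r C := by
  refine ⟨fun y => (if y = r then 1 else 0) + (C y - M.count y), ?_, by simp⟩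
  convert h.reach fun y => C y - M.count y using 1
  ext y; have := hC y; omega

theorem Feeds.exists_lt {C : V → ℕ} (hC : ¬ SemigreedySolvable G r C) {a : V}
    (ha : G.Adj r a) {M N : Multiset V} (hM : Feeds G r M a) (hN : Feeds G r N a) :
    ∃ y, C y < M.count y + N.count y := by
  by_contra! hy
  refine hC (Feeds.solvable (hM.step hN ha.symm (by simp)) fun y => ?_)
  rw [Multiset.count_add]; exact hy y

theorem apply_root_eq_zero {C : V → ℕ} (hC : ¬ SemigreedySolvable G r C) : C r = 0 := by
  by_contra h0
  exact hC ⟨C, .refl, by omega⟩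

end Feeding

section Quiet

/-- A configuration from which no pebble can be put on a neighbor of `r`. -/
structure Quiet (G : SimpleGraph V) (S K : Set V) (r : V) (C : V → ℕ) : Prop where
  root : ∀ a, G.Adj r a → C a = 0
  clique_le : ∀ x ∈ K, C x ≤ 1
  cone_le : ∀ v ∈ S, v ≠ r → C v ≤ 3
  not_adj : ∀ v ∈ S, v ≠ r → 2 ≤ C v → ∀ x, G.Adj v x → ¬ G.Adj r x
  zero : ∀ v ∈ S, v ≠ r → 2 ≤ C v → ∀ x, G.Adj v x → C x = 0
  disj : ∀ v ∈ S, v ≠ r → ∀ w ∈ S, w ≠ r → v ≠ w → 2 ≤ C v → 2 ≤ C w →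
    ∀ x, G.Adj v x → ¬ G.Adj w x

variable {G : SimpleGraph V} {S K : Set V} {r : V}

namespace IsDeepRoot

variable (h : IsDeepRoot G S K r)
include h

theorem feeds_of_cone {v x : V} (hv : v ∈ S) (hvr : v ≠ r) (hx : G.Adj v x) :
    Feeds G r ({v} + {v}) x :=
  (Feeds.base v).step (.base v) hx
    ((h.dist_le_two (h.split.mem_of_adj hv hx)).trans (h.two_le_dist hv hvr))

theorem feeds_of_clique {x a : V} (hx : x ∈ K) (ha : G.Adj r a) (hxa : x ≠ a) {M N : Multiset V}
    (hM : Feeds G r M x) (hN : Feeds G r N x) : Feeds G r (M + N) a := by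
  refine hM.step hN (h.split.adj hx (h.split.mem_of_adj h.mem ha) hxa) ?_
  rw [SimpleGraph.dist_eq_one_iff_adj.2 ha.symm]
  exact h.dist_pos (h.split.ne h.mem hx).symm

variable [DecidableEq V]

theorem quiet_of_forall {C : V → ℕ}
    (hC : ∀ a M, G.Adj r a → Feeds G r M a → ∃ y, C y < M.count y) : Quiet G S K r C := by
  obtain ⟨a, ha⟩ := h.exists_adj r
  have hroot : ∀ a, G.Adj r a → C a = 0 := by
    intro a ha
    obtain ⟨y, hy⟩ := hC a _ ha (.base a)
    rw [Multiset.count_singleton] at hy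
    split_ifs at hy with h1
    · subst h1; omega
    · omega
  have hne : ∀ {x}, ¬ G.Adj r x → x ≠ a := by rintro x hx rfl; exact hx ha
  have hna : ∀ v ∈ S, v ≠ r → 2 ≤ C v → ∀ x, G.Adj v x → ¬ G.Adj r x := by
    intro v hv hvr hCv x hvx hrx
    obtain ⟨y, hy⟩ := hC x _ hrx (h.feeds_of_cone hv hvr hvx)
    simp only [Multiset.count_add, Multiset.count_singleton] at hy
    split_ifs at hy with h1
    · subst h1; omega
    · omega
  refine ⟨hroot, fun x hx => ?_, fun v hv hvr => ?_, hna, fun v hv hvr hCv x hvx => ?_,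
    fun v hv hvr w hw hwr hvw hCv hCw x hvx hwx => ?_⟩
  · by_cases hrx : G.Adj r x
    · simp [hroot x hrx]
    · obtain ⟨y, hy⟩ := hC a _ ha (h.feeds_of_clique hx ha (hne hrx) (.base x) (.base x))
      simp only [Multiset.count_add, Multiset.count_singleton] at hy
      split_ifs at hy with h1
      · subst h1; omega
      · omega
  · by_contra! hlt
    obtain ⟨x, hvx⟩ := h.exists_adj v
    have hf := h.feeds_of_cone hv hvr hvx
    obtain ⟨y, hy⟩ := hC a _ ha (h.feeds_of_clique (h.split.mem_of_adj hv hvx) ha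
      (hne (hna v hv hvr (by omega) x hvx)) hf hf)
    simp only [Multiset.count_add, Multiset.count_singleton] at hy
    split_ifs at hy with h1
    · subst h1; omega
    · omega
  · by_contra hx0
    obtain ⟨y, hy⟩ := hC a _ ha (h.feeds_of_clique (h.split.mem_of_adj hv hvx) ha
      (hne (hna v hv hvr hCv x hvx)) (h.feeds_of_cone hv hvr hvx) (.base x))
    have := hvx.ne
    simp only [Multiset.count_add, Multiset.count_singleton] at hy
    split_ifs at hy with h1 h2 h2 <;> first | omega | (subst_vars; first | omega | contradiction)
  · obtain ⟨y, hy⟩ := hC a _ ha (h.feeds_of_clique (h.split.mem_of_adj hv hvx) ha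
      (hne (hna v hv hvr hCv x hvx)) (h.feeds_of_cone hv hvr hvx) (h.feeds_of_cone hw hwr hwx))
    simp only [Multiset.count_add, Multiset.count_singleton] at hy
    split_ifs at hy with h1 h2 h2 <;> first | omega | (subst_vars; first | omega | contradiction)

theorem quiet_sub {C : V → ℕ} (hC : ¬ SemigreedySolvable G r C) {M : Multiset V}
    (hM : ∀ a, G.Adj r a → Feeds G r M a) (hMC : ∀ y, M.count y ≤ C y) :
    Quiet G S K r fun y => C y - M.count y := by
  refine h.quiet_of_forall fun a N ha hN => ?_
  obtain ⟨y, hy⟩ := (hM a ha).exists_lt hC ha hN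
  have := hMC y
  exact ⟨y, by omega⟩

/-- A pile of two on a clique vertex can be moved to any neighbor of `r`. -/
theorem quiet_of_clique {C : V → ℕ} (hC : ¬ SemigreedySolvable G r C) {x : V} (hx : x ∈ K)
    (hrx : ¬ G.Adj r x) (hCx : 2 ≤ C x) :
    Quiet G S K r fun y => C y - if y = x then 2 else 0 := by
  have := h.quiet_sub hC (M := {x} + {x})
    (fun a ha => h.feeds_of_clique hx ha (by rintro rfl; exact hrx ha) (.base x) (.base x))
    (fun y => by
      simp only [Multiset.count_add, Multiset.count_singleton]
      split_ifs with h1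
      · subst h1; omega
      · omega)
  convert this using 3 with y
  simp only [Multiset.count_add, Multiset.count_singleton]
  split_ifs <;> rfl

theorem quiet_of_cone_clique {C : V → ℕ} (hC : ¬ SemigreedySolvable G r C) {v x : V} (hv : v ∈ S)
    (hvr : v ≠ r) (hvx : G.Adj v x) (hrx : ¬ G.Adj r x) (hCv : 2 ≤ C v) (hCx : 1 ≤ C x) :
    Quiet G S K r fun y => C y - ((if y = v then 2 else 0) + if y = x then 1 else 0) := by
  have hne := hvx.ne
  have := h.quiet_sub hC (M := ({v} + {v}) + {x})
    (fun a ha => h.feeds_of_clique (h.split.mem_of_adj hv hvx) ha (by rintro rfl; exact hrx ha)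
      (h.feeds_of_cone hv hvr hvx) (.base x))
    (fun y => by
      simp only [Multiset.count_add, Multiset.count_singleton]
      split_ifs with h1 h2 h2 <;> first | omega | (subst_vars; first | omega | contradiction))
  convert this using 3 with y
  simp only [Multiset.count_add, Multiset.count_singleton]
  split_ifs <;> rfl

theorem quiet_of_cone_cone {C : V → ℕ} (hC : ¬ SemigreedySolvable G r C) {v w x : V} (hv : v ∈ S)
    (hvr : v ≠ r) (hw : w ∈ S) (hwr : w ≠ r) (hvw : v ≠ w) (hvx : G.Adj v x) (hwx : G.Adj w x)
    (hrx : ¬ G.Adj r x) (hCv : 2 ≤ C v) (hCw : 2 ≤ C w) :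
    Quiet G S K r fun y => C y - ((if y = v then 2 else 0) + if y = w then 2 else 0) := by
  have := h.quiet_sub hC (M := ({v} + {v}) + ({w} + {w}))
    (fun a ha => h.feeds_of_clique (h.split.mem_of_adj hv hvx) ha (by rintro rfl; exact hrx ha)
      (h.feeds_of_cone hv hvr hvx) (h.feeds_of_cone hw hwr hwx))
    (fun y => by
      simp only [Multiset.count_add, Multiset.count_singleton]
      split_ifs with h1 h2 h2 <;> first | omega | (subst_vars; first | omega | contradiction))
  convert this using 3 with y
  simp only [Multiset.count_add, Multiset.count_singleton]
  split_ifs <;> rfl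

theorem quiet_of_cone {C : V → ℕ} (hC : ¬ SemigreedySolvable G r C) {v : V} (hv : v ∈ S)
    (hvr : v ≠ r) (hno : ∀ x, G.Adj v x → ¬ G.Adj r x) (hCv : 4 ≤ C v) :
    Quiet G S K r fun y => C y - if y = v then 4 else 0 := by
  obtain ⟨x, hvx⟩ := h.exists_adj v
  have hf := h.feeds_of_cone hv hvr hvx
  have hrx := hno x hvx
  have := h.quiet_sub hC (M := ({v} + {v}) + ({v} + {v}))
    (fun a ha => h.feeds_of_clique (h.split.mem_of_adj hv hvx) ha (by rintro rfl; exact hrx ha)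
      hf hf)
    (fun y => by
      simp only [Multiset.count_add, Multiset.count_singleton]
      split_ifs with h1
      · subst h1; omega
      · omega)
  convert this using 3 with y
  simp only [Multiset.count_add, Multiset.count_singleton]
  split_ifs <;> rfl

/-- If two piles on cone vertices share a neighbor outside `N_r`, all other piles are far from the
root and have pairwise disjoint neighborhoods. -/
theorem disjoint_of_shared {C : V → ℕ} (hC : ¬ SemigreedySolvable G r C) {u v x : V} (hu : u ∈ S) (hur : u ≠ r) (hv : v ∈ S)
    (hvr : v ≠ r) (huv : u ≠ v) (hCu : 2 ≤ C u) (hCv : 2 ≤ C v) (hux : G.Adj u x)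
    (hvx : G.Adj v x) (hrx : ¬ G.Adj r x) :
    (∀ w ∈ S, w ≠ r → w ≠ u → w ≠ v → 2 ≤ C w → ∀ y, G.Adj w y → ¬ G.Adj r y) ∧
    ∀ w ∈ S, w ≠ r → w ≠ u → w ≠ v → ∀ w' ∈ S, w' ≠ r → w' ≠ u → w' ≠ v → w ≠ w' → 2 ≤ C w →
      2 ≤ C w' → ∀ x, G.Adj w x → ¬ G.Adj w' x := by
  obtain ⟨D, hD, q⟩ : ∃ D : V → ℕ, (∀ y, D y = C y - ((if y = u then 2 else 0) +
      if y = v then 2 else 0)) ∧ Quiet G S K r D :=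
    ⟨_, fun _ => rfl, h.quiet_of_cone_cone hC hu hur hv hvr huv hux hvx hrx hCu hCv⟩
  have hDw : ∀ w, w ≠ u → w ≠ v → D w = C w := fun w hw hw' => by simp [hD, hw, hw']
  refine ⟨fun w hw hwr hwu hwv hCw => ?_, fun w hw hwr hwu hwv w' hw' hwr' hwu' hwv' hne hCw hCw' =>
    ?_⟩
  · rw [← hDw w hwu hwv] at hCw
    exact q.not_adj w hw hwr hCw
  · rw [← hDw w hwu hwv] at hCw
    rw [← hDw w' hwu' hwv'] at hCw'
    exact q.disj w hw hwr w' hw' hwr' hne hCw hCw'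

end IsDeepRoot

end Quiet

section Counting

open Finset

variable [Fintype V]

open Classical in
/-- The vertices that are the only neighbor of some cone vertex other than `r`. -/
noncomputable def leafSet (G : SimpleGraph V) (S : Set V) (r : V) : Finset V :=
  univ.filter fun x => HasLeaf G S r x

theorem mem_leafSet {G : SimpleGraph V} {S : Set V} {r x : V} :
    x ∈ leafSet G S r ↔ HasLeaf G S r x := by simp [leafSet]

variable [DecidableEq V] {G : SimpleGraph V} [DecidableRel G.Adj] {S K : Set V} {r : V}

theorem IsDeepRoot.sum_add_card_le (h : IsDeepRoot G S K r) {C : V → ℕ} {X Q : Finset V}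
    (hr : C r = 0) (hX : ∀ y ∈ X, 1 ≤ C y) (hQK : ∀ y ∈ Q, y ∈ K) (hQ : ∀ y ∈ Q, C y = 0)
    (hK : ∀ x ∈ K, x ∉ X → C x ≤ 1) (hS : ∀ w ∈ S, w ≠ r → w ∉ X → C w ≤ 3)
    (hN : ∀ w ∈ S, w ≠ r → w ∉ X → 2 ≤ C w → ∀ x, G.Adj w x → C x = 0 ∧ x ∉ Q)
    (hD : ∀ w ∈ S, w ≠ r → w ∉ X → ∀ w' ∈ S, w' ≠ r → w' ∉ X → w ≠ w' → 2 ≤ C w → 2 ≤ C w' →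
      ∀ x, G.Adj w x → ¬ G.Adj w' x) :
    (∑ y, (C y : ℤ)) + #Q + 1 ≤
      Fintype.card V + ∑ y ∈ X, ((C y : ℤ) - 1) + #(leafSet G S r \ Q) := by
  classical
  set W : Finset V := univ.filter fun y => y ∈ S ∧ y ≠ r ∧ y ∉ X ∧ 2 ≤ C y with hW
  have mW : ∀ {y}, y ∈ W ↔ y ∈ S ∧ y ≠ r ∧ y ∉ X ∧ 2 ≤ C y := by simp [hW]
  set Z : Finset V := Q ∪ W.biUnion fun w => G.neighborFinset w with hZ
  have mZ : ∀ {y}, y ∈ Z ↔ y ∈ Q ∨ ∃ w ∈ W, G.Adj w y := by simp [hZ]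
  have cZ : #Z = #Q + ∑ w ∈ W, G.degree w := by
    rw [hZ, card_union_of_disjoint, card_biUnion]
    · simp
    · intro w hw w' hw' hne
      rw [mem_coe, mW] at hw hw'
      change Disjoint (G.neighborFinset w) (G.neighborFinset w')
      rw [disjoint_left]
      intro x hx hx'
      rw [SimpleGraph.mem_neighborFinset] at hx hx'
      exact hD w hw.1 hw.2.1 hw.2.2.1 w' hw'.1 hw'.2.1 hw'.2.2.1 hne hw.2.2.2 hw'.2.2.2 x hx hx'
    · rw [disjoint_left]
      intro x hx hx'
      simp only [mem_biUnion, SimpleGraph.mem_neighborFinset] at hx'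
      obtain ⟨w, hw, hwx⟩ := hx'
      rw [mW] at hw
      exact (hN w hw.1 hw.2.1 hw.2.2.1 hw.2.2.2 x hwx).2 hx
  have pt : ∀ y, (C y : ℤ) ≤ 1 + (if y ∈ X then (C y : ℤ) - 1 else 0) +
      (if y ∈ W then 2 else 0) - (if y ∈ Z then 1 else 0) - (if y = r then 1 else 0) := by
    intro y
    have hZ0 : y ∈ Z → C y = 0 ∧ y ∈ K := by
      rw [mZ]
      rintro (hy | ⟨w, hw, hwy⟩)
      · exact ⟨hQ y hy, hQK y hy⟩
      · rw [mW] at hw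
        exact ⟨(hN w hw.1 hw.2.1 hw.2.2.1 hw.2.2.2 y hwy).1, h.split.mem_of_adj hw.1 hwy⟩
    by_cases hyr : y = r
    · subst hyr
      have h1 : y ∉ Z := fun hy => h.split.not_mem_right h.mem (hZ0 hy).2
      have h2 : y ∉ X := fun hy => by have := hX y hy; omega
      have h3 : y ∉ W := by simp [mW]
      simp [h1, h2, h3, hr]
    · by_cases hyX : y ∈ X
      · have h1 : y ∉ Z := fun hy => by have := hX y hyX; have := (hZ0 hy).1; omega
        have h3 : y ∉ W := by simp [mW, hyX]
        simp [h1, hyX, h3, hyr]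
      · by_cases hyZ : y ∈ Z
        · have h3 : y ∉ W := fun hy => h.split.not_mem_right (mW.1 hy).1 (hZ0 hyZ).2
          simp [hyX, hyZ, h3, hyr, (hZ0 hyZ).1]
        · by_cases hyW : y ∈ W
          · have := hS y (mW.1 hyW).1 hyr hyX
            simp [hyX, hyZ, hyW, hyr]; omega
          · have : C y ≤ 1 := by
              rcases h.split.mem_or y with hs | hk
              · by_contra! hlt
                exact hyW (mW.2 ⟨hs, hyr, hyX, hlt⟩)
              · exact hK y hk hyX
            simp [hyX, hyZ, hyW, hyr]; omega
  have tot := sum_le_sum fun y (_ : y ∈ univ) => pt y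
  have leaf : ∑ w ∈ W, (2 - (G.degree w : ℤ)) ≤ #(leafSet G S r \ Q) := by
    have h1 : ∑ w ∈ W, (2 - (G.degree w : ℤ)) ≤ #(W.filter fun w => G.degree w = 1) := by
      rw [card_filter, Nat.cast_sum]
      refine sum_le_sum fun w _ => ?_
      have := h.one_le_degree w
      split_ifs <;> push_cast <;> omega
    refine h1.trans ?_
    norm_cast
    choose f hf using h.exists_adj
    refine card_le_card_of_injOn f ?_ ?_
    · intro w hw
      simp only [coe_filter, Set.mem_ofPred_eq, mW] at hw
      simp only [coe_sdiff, Set.mem_sdiff, mem_coe, mem_leafSet]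
      refine ⟨⟨w, hw.1.1, hw.1.2.1, ?_⟩, (hN w hw.1.1 hw.1.2.1 hw.1.2.2.1 hw.1.2.2.2 _ (hf w)).2⟩
      rw [← SimpleGraph.card_neighborFinset_eq_degree, card_eq_one] at hw
      obtain ⟨z, hz⟩ := hw.2
      have h2 : f w ∈ G.neighborFinset w := by simpa using hf w
      rw [hz, mem_singleton] at h2
      rw [h2, ← SimpleGraph.coe_neighborFinset, hz, coe_singleton]
    · intro w hw w' hw' he
      simp only [coe_filter, Set.mem_ofPred_eq, mW] at hw hw'
      by_contra hne
      exact hD w hw.1.1 hw.1.2.1 hw.1.2.2.1 w' hw'.1.1 hw'.1.2.1 hw'.1.2.2.1 hne hw.1.2.2.2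
        hw'.1.2.2.2 (f w) (hf w) (he ▸ hf w')
  simp only [sum_sub_distrib, sum_add_distrib, sum_ite_mem, univ_inter, sum_ite_eq', mem_univ,
    if_true, sum_const, card_univ, nsmul_eq_mul, mul_one] at tot leaf
  rw [cZ] at tot
  push_cast at tot leaf
  simp only [sum_sub_distrib, sum_const, nsmul_eq_mul, mul_one]
  linarith

end Counting

section Bounds

open Finset

variable {G : SimpleGraph V} {S K : Set V} {r s : V}

theorem cutRS_nonneg : 0 ≤ cutRS G K r s := by simp [cutRS]

theorem cutR0_nonneg : 0 ≤ cutR0 G S r := by simp [cutR0]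

theorem HasLeaf.mem_clique (h : IsDeepRoot G S K r) {x : V} (hx : HasLeaf G S r x) : x ∈ K := by
  obtain ⟨l, hl, -, hlx⟩ := hx
  refine h.split.mem_of_adj hl ?_
  rw [← SimpleGraph.mem_neighborSet, hlx]; rfl

variable [Fintype V]

theorem HasLeaf.isCutVertex (h : IsDeepRoot G S K r) {x : V} (hx : HasLeaf G S r x) :
    IsCutVertex G x := by
  obtain ⟨l, hl, -, hlx⟩ := hx
  exact h.isCutVertex_iff.2 ⟨l, hl, hlx⟩

variable [DecidableRel G.Adj]

theorem phoenixIndicator_nonneg : 0 ≤ phoenixIndicator G S r := by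
  unfold phoenixIndicator; split_ifs <;> norm_num

theorem le_tMax : tRS G K r s ≤ tMax G S K r s ∧ tR G K r s ≤ tMax G S K r s ∧
    tS G S K r s ≤ tMax G S K r s ∧ tZero G S K r s ≤ tMax G S K r s := by
  simp [tMax]

namespace IsDeepRoot

variable (h : IsDeepRoot G S K r)
include h

theorem farMinDegree_eq_one_of_hasLeaf {x : V} (hx : HasLeaf G S r x) (hrx : ¬ G.Adj r x) :
    farMinDegree G r = 1 := by
  obtain ⟨l, hl, hlr, hlx⟩ := hx
  have hfar : IsFar G S r l := by
    refine ⟨hl, hlr, fun y hy => ?_⟩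
    rw [← SimpleGraph.mem_neighborSet, hlx, Set.mem_singleton_iff] at hy
    rwa [hy]
  have h1 := h.farMinDegree_le hfar
  have h2 : G.degree l = 1 := by
    rw [← SimpleGraph.card_neighborFinset_eq_degree, card_eq_one]
    exact ⟨x, by rw [← coe_inj, SimpleGraph.coe_neighborFinset, hlx, coe_singleton]⟩
  obtain ⟨s, -, hs⟩ := h.exists_degree_eq_farMinDegree
  have := h.one_le_degree s
  omega

variable [DecidableEq V]

theorem farLeaf_eq_empty (hd : 2 ≤ farMinDegree G r) :
    leafSet G S r \ G.neighborFinset r = ∅ := by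
  by_contra hne
  obtain ⟨x, hx⟩ := nonempty_iff_ne_empty.2 hne
  simp only [mem_sdiff, mem_leafSet, SimpleGraph.mem_neighborFinset] at hx
  have := h.farMinDegree_eq_one_of_hasLeaf hx.1 hx.2
  omega

theorem card_farLeaf_le (hd : G.degree s = farMinDegree G r) :
    (#(leafSet G S r \ G.neighborFinset r) : ℤ) ≤ cutRS G K r s + 1 := by
  by_cases h2 : 2 ≤ farMinDegree G r
  · rw [h.farLeaf_eq_empty h2]
    have := cutRS_nonneg (G := G) (K := K) (r := r) (s := s)
    simp; omega
  · have h1 : #((leafSet G S r \ G.neighborFinset r) \ G.neighborFinset s) ≤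
        {x : V | x ∈ K ∧ IsCutVertex G x ∧ ¬ G.Adj r x ∧ ¬ G.Adj s x}.ncard := by
      rw [← Set.ncard_coe_finset]
      refine Set.ncard_le_ncard (fun x hx => ?_) (Set.toFinite _)
      simp only [coe_sdiff, Set.mem_sdiff, mem_coe, mem_leafSet,
        SimpleGraph.mem_neighborFinset] at hx
      exact ⟨hx.1.1.mem_clique h, hx.1.1.isCutVertex h, hx.1.2, hx.2⟩
    have h3 := le_card_sdiff (G.neighborFinset s) (leafSet G S r \ G.neighborFinset r)
    rw [SimpleGraph.card_neighborFinset_eq_degree] at h3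
    unfold cutRS
    omega

theorem card_leafSet_le :
    (#(leafSet G S r) : ℤ) ≤ #(leafSet G S r \ G.neighborFinset r) + cutR0 G S r := by
  have h1 : #(leafSet G S r ∩ G.neighborFinset r) ≤
      {x : V | IsCutVertex G x ∧ G.Adj r x ∧ ∃ v ∈ S, v ≠ r ∧ G.Adj v x}.ncard := by
    rw [← Set.ncard_coe_finset]
    refine Set.ncard_le_ncard (fun x hx => ?_) (Set.toFinite _)
    simp only [coe_inter, Set.mem_inter_iff, mem_coe, mem_leafSet,
      SimpleGraph.mem_neighborFinset] at hx
    refine ⟨hx.1.isCutVertex h, hx.2, ?_⟩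
    obtain ⟨l, hl, hlr, hlx⟩ := hx.1
    exact ⟨l, hl, hlr, by rw [← SimpleGraph.mem_neighborSet, hlx]; rfl⟩
  have h2 := card_sdiff_add_card_inter (leafSet G S r) (G.neighborFinset r)
  unfold cutR0
  omega

variable (hd : G.degree s = farMinDegree G r)
include hd

theorem lt_of_card_leafSet {T : ℤ} (hT : T + 1 ≤ Fintype.card V + #(leafSet G S r)) :
    T < tMax G S K r s + phoenixIndicator G S r := by
  have h1 := h.card_leafSet_le
  have h2 := h.card_farLeaf_le hd
  have h3 := le_tMax (G := G) (S := S) (K := K) (r := r) (s := s)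
  have h4 := phoenixIndicator_nonneg (G := G) (S := S) (r := r)
  have h5 := cutRS_nonneg (G := G) (K := K) (r := r) (s := s)
  have h6 := h.one_le_degree s
  by_cases h7 : 2 ≤ farMinDegree G r
  · rw [h.farLeaf_eq_empty h7, card_empty] at h1
    simp only [tZero] at h3
    omega
  · simp only [tS] at h3
    omega

theorem lt_of_two {T : ℤ}
    (hT : T + G.degree r + 1 ≤ Fintype.card V + 2 + #(leafSet G S r \ G.neighborFinset r)) :
    T < tMax G S K r s + phoenixIndicator G S r := by
  have h2 := h.card_farLeaf_le hd
  have h3 := le_tMax (G := G) (S := S) (K := K) (r := r) (s := s)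
  have h4 := phoenixIndicator_nonneg (G := G) (S := S) (r := r)
  have h5 := cutRS_nonneg (G := G) (K := K) (r := r) (s := s)
  by_cases h7 : 2 ≤ farMinDegree G r
  · rw [h.farLeaf_eq_empty h7, card_empty] at hT
    simp only [tR] at h3
    omega
  · simp only [tRS] at h3
    omega

theorem lt_of_three {T : ℤ} {q : ℕ} (hq : farMinDegree G r ≤ q + 1)
    (hT : T + G.degree r + q + 1 ≤
      Fintype.card V + 3 + #(leafSet G S r \ G.neighborFinset r)) :
    T < tMax G S K r s + phoenixIndicator G S r := by
  have h2 := h.card_farLeaf_le hd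
  have h3 := le_tMax (G := G) (S := S) (K := K) (r := r) (s := s)
  have h4 := phoenixIndicator_nonneg (G := G) (S := S) (r := r)
  have h5 := cutRS_nonneg (G := G) (K := K) (r := r) (s := s)
  by_cases h7 : 2 ≤ farMinDegree G r
  · rw [h.farLeaf_eq_empty h7, card_empty] at hT
    simp only [tR] at h3
    omega
  · simp only [tRS] at h3
    omega

theorem lt_of_four {T : ℤ} {q : ℕ} (hq : farMinDegree G r ≤ q + 1)
    (hT : T + G.degree r + q + 1 ≤
      Fintype.card V + 4 + #(leafSet G S r \ G.neighborFinset r)) :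
    T < tMax G S K r s + phoenixIndicator G S r := by
  have h2 := h.card_farLeaf_le hd
  have h3 := le_tMax (G := G) (S := S) (K := K) (r := r) (s := s)
  have h4 := phoenixIndicator_nonneg (G := G) (S := S) (r := r)
  have h5 := cutRS_nonneg (G := G) (K := K) (r := r) (s := s)
  have h6 := h.one_le_degree s
  by_cases h7 : 2 ≤ farMinDegree G r
  · rw [h.farLeaf_eq_empty h7, card_empty] at hT
    simp only [tRS] at h3
    omega
  · simp only [tRS] at h3
    omega

theorem lt_of_six {T : ℤ} {v : V} (hv : IsFar G S r v) {Q : Finset V}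
    (hvQ : G.neighborFinset v ⊆ Q)
    (hT : T + G.degree r + #Q + 1 ≤
      Fintype.card V + 6 + #((leafSet G S r \ G.neighborFinset r) \ Q)) :
    T < tMax G S K r s + phoenixIndicator G S r := by
  have h2 := h.card_farLeaf_le hd
  have h3 := le_tMax (G := G) (S := S) (K := K) (r := r) (s := s)
  have h4 := phoenixIndicator_nonneg (G := G) (S := S) (r := r)
  have h5 := cutRS_nonneg (G := G) (K := K) (r := r) (s := s)
  have h6 := h.farMinDegree_le hv
  have h6' := h.one_le_degree s
  have h8 := card_le_card hvQ
  rw [SimpleGraph.card_neighborFinset_eq_degree] at h8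
  simp only [tRS] at h3
  by_cases h7 : 2 ≤ farMinDegree G r
  · rw [h.farLeaf_eq_empty h7, empty_sdiff, card_empty] at hT
    omega
  · have h9 : #((leafSet G S r \ G.neighborFinset r) \ Q) ≤
      #(leafSet G S r \ G.neighborFinset r) := card_le_card sdiff_subset
    by_cases hq : 2 ≤ #Q
    · omega
    · have hv1 : #(G.neighborFinset v) = 1 := by
        rw [SimpleGraph.card_neighborFinset_eq_degree]; omega
      obtain ⟨x, hx⟩ := card_eq_one.1 hv1
      have hvx : G.Adj v x := by simpa using (hx ▸ mem_singleton_self x : x ∈ G.neighborFinset v)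
      have hxm : x ∈ leafSet G S r \ G.neighborFinset r := by
        simp only [mem_sdiff, mem_leafSet, SimpleGraph.mem_neighborFinset]
        refine ⟨⟨v, hv.1, hv.2.1, ?_⟩, hv.2.2 x hvx⟩
        rw [← SimpleGraph.coe_neighborFinset, hx, coe_singleton]
      have : #((leafSet G S r \ G.neighborFinset r) \ Q) <
          #(leafSet G S r \ G.neighborFinset r) := by
        refine card_lt_card ⟨sdiff_subset, fun hsub => ?_⟩
        exact (mem_sdiff.1 (hsub hxm)).2 (hvQ (by simpa using hvx))
      omega

/-- The extremal situation for two cone vertices at distance two from the root, which share a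
neighbor outside `N_r`: it exceeds the generic bound only if `G` is `r`-Phoenix. -/
theorem lt_of_near_pair {T : ℤ} {u v : V} (hu : u ∈ S) (hur : u ≠ r) (hv : v ∈ S) (hvr : v ≠ r)
    {a b x : V} (hra : G.Adj r a) (hua : G.Adj u a) (hrb : G.Adj r b) (hvb : G.Adj v b)
    (hdisj : ∀ y, G.Adj r y → G.Adj u y → ¬ G.Adj v y) (hux : G.Adj u x) (hvx : G.Adj v x)
    (hT : T + G.degree r +
        #((G.neighborFinset u ∪ G.neighborFinset v) \ G.neighborFinset r) + 1 ≤
      Fintype.card V + 4 + #(leafSet G S r \ G.neighborFinset r)) :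
    T < tMax G S K r s + phoenixIndicator G S r := by
  have hrx : ¬ G.Adj r x := fun hrx => hdisj x hrx hux hvx
  have hab : a ≠ b := by rintro rfl; exact hdisj a hra hua hvb
  set Q := (G.neighborFinset u ∪ G.neighborFinset v) \ G.neighborFinset r with hQ
  have mQ : ∀ {y}, y ∈ Q ↔ (G.Adj u y ∨ G.Adj v y) ∧ ¬ G.Adj r y := by simp [hQ]
  have hxQ : x ∈ Q := mQ.2 ⟨.inl hux, hrx⟩
  have hQ1 : 1 ≤ #Q := card_pos.2 ⟨x, hxQ⟩
  have hr2 : {a, b} ⊆ G.neighborFinset r := by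
    intro y; simp only [mem_insert, mem_singleton, SimpleGraph.mem_neighborFinset]
    rintro (rfl | rfl) <;> assumption
  have hr2' := card_le_card hr2
  rw [card_pair hab, SimpleGraph.card_neighborFinset_eq_degree] at hr2'
  have h2 := h.card_farLeaf_le hd
  have h3 := le_tMax (G := G) (S := S) (K := K) (r := r) (s := s)
  have h4 := phoenixIndicator_nonneg (G := G) (S := S) (r := r)
  have h5 := cutRS_nonneg (G := G) (K := K) (r := r) (s := s)
  have h5' := cutR0_nonneg (G := G) (S := S) (r := r)
  have h6' := h.one_le_degree s
  by_cases h7 : 2 ≤ farMinDegree G r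
  swap
  · simp only [tRS] at h3
    omega
  rw [h.farLeaf_eq_empty h7, card_empty] at hT
  simp only [tRS, tR, tZero] at h3
  by_cases c1 : 2 ≤ #Q
  · omega
  by_cases c2 : farMinDegree G r ≤ 3
  · omega
  by_cases c3 : 3 ≤ G.degree r
  · omega
  by_cases c4 : 1 ≤ cutR0 G S r
  · omega
  have hcut : ∀ y, G.Adj r y → (∃ w ∈ S, w ≠ r ∧ G.Adj w y) → ¬ IsCutVertex G y := by
    intro y hy hw hcy
    apply c4
    unfold cutR0
    have : 0 < {x : V | IsCutVertex G x ∧ G.Adj r x ∧ ∃ v ∈ S, v ≠ r ∧ G.Adj v x}.ncard :=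
      (Set.ncard_pos (Set.toFinite _)).2 ⟨y, hcy, hy, hw⟩
    omega
  have hNr : ({a, b} : Finset V) = G.neighborFinset r := eq_of_subset_of_card_le hr2 (by
    rw [card_pair hab, SimpleGraph.card_neighborFinset_eq_degree]; omega)
  have hNr' : ∀ y, G.Adj r y ↔ y = a ∨ y = b := by
    intro y; rw [← SimpleGraph.mem_neighborFinset, ← hNr]; simp
  have hQx : ∀ y ∈ Q, y = x := fun y hy => by
    by_contra hne
    apply c1
    exact one_lt_card.2 ⟨y, hy, x, hxQ, hne⟩
  have hphx : phoenixIndicator G S r = 1 := by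
    unfold phoenixIndicator
    rw [if_pos]
    refine ⟨⟨u, hu, v, hv, a, b, x, h.mem, hab, ?_, ?_, ?_, ?_, ?_, ?_⟩, h.ecc, by omega⟩
    · rintro rfl; exact hrx hra
    · rintro rfl; exact hrx hrb
    · ext y; simp [hNr']
    · ext y
      simp only [SimpleGraph.mem_neighborSet, Set.mem_insert_iff, Set.mem_singleton_iff]
      constructor
      · intro hy
        by_cases hry : G.Adj r y
        · rcases (hNr' y).1 hry with h1 | rfl
          · exact .inl h1
          · exact absurd hvb (hdisj _ hry hy)
        · exact .inr (hQx y (mQ.2 ⟨.inl hy, hry⟩))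
      · rintro (rfl | rfl) <;> assumption
    · ext y
      simp only [SimpleGraph.mem_neighborSet, Set.mem_insert_iff, Set.mem_singleton_iff]
      constructor
      · intro hy
        by_cases hry : G.Adj r y
        · rcases (hNr' y).1 hry with rfl | h1
          · exact absurd hy (hdisj _ hry hua)
          · exact .inl h1
        · exact .inr (hQx y (mQ.2 ⟨.inr hy, hry⟩))
      · rintro (rfl | rfl) <;> assumption
    · simp only [Set.mem_insert_iff, Set.mem_singleton_iff]
      rintro y (rfl | rfl | rfl | rfl | rfl | rfl)
      · exact h.not_isCutVertex_of_mem h.mem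
      · exact h.not_isCutVertex_of_mem hu
      · exact h.not_isCutVertex_of_mem hv
      · exact hcut _ hra ⟨u, hu, hur, hua⟩
      · exact hcut _ hrb ⟨v, hv, hvr, hvb⟩
      · rw [h.isCutVertex_iff]
        rintro ⟨l, hl, hlx⟩
        have := h.farMinDegree_eq_one_of_hasLeaf (x := y) ⟨l, hl, ?_, hlx⟩ hrx
        · omega
        · rintro rfl
          apply hrx
          rw [← SimpleGraph.mem_neighborSet, hlx]; rfl
  omega

end IsDeepRoot

end Bounds

section Upper

open Finset

variable [Fintype V] [DecidableEq V] {G : SimpleGraph V} [DecidableRel G.Adj] {S K : Set V}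
  {r s : V} {C : V → ℕ}

namespace IsDeepRoot

variable (h : IsDeepRoot G S K r)
include h

theorem sum_le_of_root_zero {X Q : Finset V} {e : ℤ}
    (hA : ∀ a, G.Adj r a → C a = 0) (hr : C r = 0) (hX : ∀ y ∈ X, 1 ≤ C y)
    (hXe : ∑ y ∈ X, ((C y : ℤ) - 1) ≤ e)
    (hQ : ∀ y ∈ Q, y ∈ K ∧ ¬ G.Adj r y ∧ C y = 0)
    (hK : ∀ x ∈ K, x ∉ X → C x ≤ 1) (hS : ∀ w ∈ S, w ≠ r → w ∉ X → C w ≤ 3)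
    (hN : ∀ w ∈ S, w ≠ r → w ∉ X → 2 ≤ C w → ∀ x, G.Adj w x →
      ¬ G.Adj r x ∧ C x = 0 ∧ x ∉ Q)
    (hD : ∀ w ∈ S, w ≠ r → w ∉ X → ∀ w' ∈ S, w' ≠ r → w' ∉ X → w ≠ w' → 2 ≤ C w → 2 ≤ C w' →
      ∀ x, G.Adj w x → ¬ G.Adj w' x) :
    (∑ y, (C y : ℤ)) + G.degree r + #Q + 1 ≤
      Fintype.card V + e + #((leafSet G S r \ G.neighborFinset r) \ Q) := by
  have hdisj : Disjoint (G.neighborFinset r) Q := by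
    rw [disjoint_left]
    intro y hy hyQ
    exact (hQ y hyQ).2.1 (by simpa using hy)
  have := h.sum_add_card_le (C := C) (X := X) (Q := G.neighborFinset r ∪ Q) hr hX
    (fun y hy => by
      rcases mem_union.1 hy with hy | hy
      · exact h.split.mem_of_adj h.mem (by simpa using hy)
      · exact (hQ y hy).1)
    (fun y hy => by
      rcases mem_union.1 hy with hy | hy
      · exact hA y (by simpa using hy)
      · exact (hQ y hy).2.2) hK hS
    (fun w hw hwr hwX hCw x hwx => by
      obtain ⟨h1, h2, h3⟩ := hN w hw hwr hwX hCw x hwx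
      exact ⟨h2, by simp [h1, h3]⟩) hD
  rw [card_union_of_disjoint hdisj, SimpleGraph.card_neighborFinset_eq_degree,
    sdiff_union_distrib, ← Finset.sdiff_sdiff_left'] at this
  push_cast at this
  linarith

variable (hd : G.degree s = farMinDegree G r) (hC : ¬ SemigreedySolvable G r C)
include hd hC

theorem sum_lt_of_pebbled {a : V} (ha : G.Adj r a) (hCa : 1 ≤ C a) :
    (∑ y, (C y : ℤ)) < tMax G S K r s + phoenixIndicator G S r := by
  refine h.lt_of_card_leafSet hd ?_
  have key : ∀ {x : V} {M N : Multiset V}, x ∈ K → Feeds G r M x → Feeds G r N x →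
      (∀ y, M.count y + N.count y + (if y = a ∧ x ≠ a then 1 else 0) ≤ C y) → False := by
    intro x M N hx hM hN hle
    by_cases hxa : x = a
    · subst hxa
      obtain ⟨y, hy⟩ := hM.exists_lt hC ha hN
      have := hle y
      omega
    · obtain ⟨y, hy⟩ := (h.feeds_of_clique hx ha hxa hM hN).exists_lt hC ha (.base a)
      have := hle y
      rw [Multiset.count_add, Multiset.count_singleton] at hy
      grind
  have haK := h.split.mem_of_adj h.mem ha
  have hK : ∀ x ∈ K, C x ≤ 1 := by
    intro x hx
    by_contra! hlt
    refine key hx (.base x) (.base x) fun y => ?_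
    simp only [Multiset.count_singleton]
    grind
  have hne : ∀ v ∈ S, v ≠ a := fun v hv => h.split.ne hv haK
  have hS : ∀ w ∈ S, w ≠ r → C w ≤ 3 := by
    intro w hw hwr
    by_contra! hlt
    obtain ⟨x, hwx⟩ := h.exists_adj w
    have hf := h.feeds_of_cone hw hwr hwx
    refine key (h.split.mem_of_adj hw hwx) hf hf fun y => ?_
    simp only [Multiset.count_add, Multiset.count_singleton]
    have := hne w hw
    grind
  have := h.sum_add_card_le (C := C) (X := ∅) (Q := ∅) (apply_root_eq_zero hC) (by simp) (by simp)
    (by simp) (fun x hx _ => hK x hx) (fun w hw hwr _ => hS w hw hwr)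
    (fun w hw hwr _ hCw x hwx => ⟨by
      by_contra hx0
      have hxK := h.split.mem_of_adj hw hwx
      have := hne w hw
      have := hwx.ne
      by_cases hrx : G.Adj r x
      · obtain ⟨y, hy⟩ := (h.feeds_of_cone hw hwr hwx).exists_lt hC hrx (.base x)
        simp only [Multiset.count_add, Multiset.count_singleton] at hy
        grind
      · refine key hxK (h.feeds_of_cone hw hwr hwx) (.base x) fun y => ?_
        simp only [Multiset.count_add, Multiset.count_singleton]
        grind, by simp⟩)
    (fun w hw hwr _ w' hw' hwr' _ hne' hCw hCw' x hwx hwx' => by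
      have := hne w hw
      have := hne w' hw'
      refine key (h.split.mem_of_adj hw hwx) (h.feeds_of_cone hw hwr hwx)
        (h.feeds_of_cone hw' hwr' hwx') fun y => ?_
      simp only [Multiset.count_add, Multiset.count_singleton]
      grind)
  simp only [sum_empty, card_empty, sdiff_empty] at this
  push_cast at this
  linarith

variable (hA : ∀ a, G.Adj r a → C a = 0)
include hA

theorem sum_lt_of_clique_pile {x : V} (hx : x ∈ K) (hCx : 2 ≤ C x) :
    (∑ y, (C y : ℤ)) < tMax G S K r s + phoenixIndicator G S r := by
  have hrx : ¬ G.Adj r x := fun hrx => by have := hA x hrx; omega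
  have q := h.quiet_of_clique hC hx hrx hCx
  obtain ⟨D, hD⟩ : ∃ D : V → ℕ, D = fun y => C y - if y = x then 2 else 0 := ⟨_, rfl⟩
  rw [← hD] at q
  have hDx : D x = C x - 2 := by simp [hD]
  have hDy : ∀ y, y ≠ x → D y = C y := fun y hy => by simp [hD, hy]
  have hSx : ∀ w ∈ S, D w = C w := fun w hw => hDy w (h.split.ne hw hx)
  have hx1 := q.clique_le x hx
  by_cases hv : ∃ v ∈ S, v ≠ r ∧ 2 ≤ C v ∧ G.Adj v x
  · obtain ⟨v, hv, hvr, hCv, hvx⟩ := hv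
    have hvx0 := q.zero v hv hvr (by rw [hSx v hv]; exact hCv) x hvx
    have hv3 := q.cone_le v hv hvr
    rw [hSx v hv] at hv3
    have hfar := q.not_adj v hv hvr (by rw [hSx v hv]; exact hCv)
    refine h.lt_of_three hd (q := #((G.neighborFinset v).erase x)) ?_ ?_
    · rw [card_erase_add_one (by simpa using hvx), SimpleGraph.card_neighborFinset_eq_degree]
      exact h.farMinDegree_le ⟨hv, hvr, hfar⟩
    · have hvx' := h.split.ne hv hx
      refine (h.sum_le_of_root_zero (X := {x, v}) (Q := (G.neighborFinset v).erase x) (e := 3)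
        hA (apply_root_eq_zero hC) ?_ ?_ ?_ ?_ ?_ ?_ ?_).trans ?_
      · simp only [mem_insert, mem_singleton]; rintro y (rfl | rfl) <;> omega
      · rw [sum_pair hvx'.symm]; omega
      · intro y hy
        rw [mem_erase, SimpleGraph.mem_neighborFinset] at hy
        exact ⟨h.split.mem_of_adj hv hy.2, hfar y hy.2, by
          rw [← hDy y hy.1]; exact q.zero v hv hvr (by rw [hSx v hv]; exact hCv) y hy.2⟩
      · intro y hy hyX
        rw [← hDy y (by rintro rfl; simp at hyX)]; exact q.clique_le y hy
      · intro w hw hwr _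
        rw [← hSx w hw]; exact q.cone_le w hw hwr
      · intro w hw hwr hwX hCw y hwy
        have hwv : v ≠ w := by rintro rfl; simp at hwX
        rw [← hSx w hw] at hCw
        have hdj : ∀ y, G.Adj v y → ¬ G.Adj w y :=
          q.disj v hv hvr w hw hwr hwv (by rw [hSx v hv]; exact hCv) hCw
        refine ⟨q.not_adj w hw hwr hCw y hwy, ?_, ?_⟩
        · rw [← hDy y (by rintro rfl; exact hdj y hvx hwy)]
          exact q.zero w hw hwr hCw y hwy
        · simp only [mem_erase, SimpleGraph.mem_neighborFinset]
          exact fun hy => hdj y hy.2 hwy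
      · intro w hw hwr _ w' hw' hwr' _ hne hCw hCw'
        rw [← hSx w hw] at hCw
        rw [← hSx w' hw'] at hCw'
        exact q.disj w hw hwr w' hw' hwr' hne hCw hCw'
      · have := card_le_card
          (sdiff_subset (s := leafSet G S r \ G.neighborFinset r)
            (t := (G.neighborFinset v).erase x))
        omega
  · push Not at hv
    refine h.lt_of_two hd ?_
    have := h.sum_le_of_root_zero (X := {x}) (Q := ∅) (e := 2)
      hA (apply_root_eq_zero hC) ?_ ?_ ?_ ?_ ?_ ?_ ?_
    · simpa using this
    · simp only [mem_singleton]; rintro y rfl; omega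
    · rw [sum_singleton]; omega
    · simp
    · intro y hy hyX
      rw [← hDy y (by simpa using hyX)]; exact q.clique_le y hy
    · intro w hw hwr _
      rw [← hSx w hw]; exact q.cone_le w hw hwr
    · intro w hw hwr hwX hCw y hwy
      have hyx : y ≠ x := by rintro rfl; exact hv w hw hwr hCw hwy
      rw [← hSx w hw] at hCw
      exact ⟨q.not_adj w hw hwr hCw y hwy, by rw [← hDy y hyx]; exact q.zero w hw hwr hCw y hwy,
        by simp⟩
    · intro w hw hwr _ w' hw' hwr' _ hne hCw hCw'
      rw [← hSx w hw] at hCw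
      rw [← hSx w' hw'] at hCw'
      exact q.disj w hw hwr w' hw' hwr' hne hCw hCw'

theorem sum_lt_of_cone_pile (hK : ∀ x ∈ K, C x ≤ 1) {v : V} (hv : v ∈ S) (hvr : v ≠ r)
    (hCv : 4 ≤ C v) :
    (∑ y, (C y : ℤ)) < tMax G S K r s + phoenixIndicator G S r := by
  have hfar : ∀ x, G.Adj v x → ¬ G.Adj r x := by
    intro x hvx hrx
    have hf := h.feeds_of_cone hv hvr hvx
    obtain ⟨y, hy⟩ := hf.exists_lt hC hrx hf
    simp only [Multiset.count_add, Multiset.count_singleton] at hy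
    grind
  have hdv := h.farMinDegree_le ⟨hv, hvr, hfar⟩
  have hr0 := apply_root_eq_zero hC
  obtain ⟨D, hD, q⟩ : ∃ D : V → ℕ, (∀ y, D y = C y - if y = v then 4 else 0) ∧ Quiet G S K r D :=
    ⟨_, fun _ => rfl, h.quiet_of_cone hC hv hvr hfar hCv⟩
  have hDv : D v = C v - 4 := by simp [hD]
  have hDy : ∀ y, y ≠ v → D y = C y := fun y hy => by simp [hD, hy]
  have hv7 := q.cone_le v hv hvr
  have hvK : ∀ y ∈ K, D y = C y := fun y hy => hDy y (h.split.ne hv hy).symm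
  have hz : ∀ w ∈ S, w ≠ r → w ≠ v → 2 ≤ C w → ∀ x, G.Adj w x → ¬ G.Adj r x ∧ C x = 0 := by
    intro w hw hwr hwv hCw x hwx
    rw [← hDy w hwv] at hCw
    refine ⟨q.not_adj w hw hwr hCw x hwx, ?_⟩
    rw [← hvK x (h.split.mem_of_adj hw hwx)]
    exact q.zero w hw hwr hCw x hwx
  have hj : ∀ w ∈ S, w ≠ r → w ≠ v → ∀ w' ∈ S, w' ≠ r → w' ≠ v → w ≠ w' → 2 ≤ C w → 2 ≤ C w' →
      ∀ x, G.Adj w x → ¬ G.Adj w' x := by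
    intro w hw hwr hwv w' hw' hwr' hwv' hne hCw hCw'
    rw [← hDy w hwv] at hCw
    rw [← hDy w' hwv'] at hCw'
    exact q.disj w hw hwr w' hw' hwr' hne hCw hCw'
  have h3 : ∀ w ∈ S, w ≠ r → w ≠ v → C w ≤ 3 := by
    intro w hw hwr hwv
    rw [← hDy w hwv]; exact q.cone_le w hw hwr
  by_cases hx : ∃ x, G.Adj v x ∧ 1 ≤ C x
  · obtain ⟨x, hvx, hCx⟩ := hx
    have hxK := h.split.mem_of_adj hv hvx
    obtain ⟨E, hE, p⟩ : ∃ E : V → ℕ, (∀ y, E y = C y - ((if y = v then 2 else 0) +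
        if y = x then 1 else 0)) ∧ Quiet G S K r E :=
      ⟨_, fun _ => rfl, h.quiet_of_cone_clique hC hv hvr hvx (hfar x hvx) (by omega) hCx⟩
    have hEv : E v = C v - 2 := by simp [hE, hvx.ne]
    have hEy : ∀ y, y ≠ v → y ≠ x → E y = C y := fun y hy hy' => by simp [hE, hy, hy']
    have hv5 := p.cone_le v hv hvr
    have hvE : 2 ≤ E v := by omega
    refine h.lt_of_four hd (q := #((G.neighborFinset v).erase x)) ?_ ?_
    · rwa [card_erase_add_one (by simpa using hvx), SimpleGraph.card_neighborFinset_eq_degree]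
    · refine (h.sum_le_of_root_zero (X := {v}) (Q := (G.neighborFinset v).erase x) (e := 4)
        hA hr0 ?_ ?_ ?_ (fun y hy _ => hK y hy) ?_ ?_ ?_).trans ?_
      · simp only [mem_singleton]; rintro y rfl; omega
      · rw [sum_singleton]; omega
      · intro y hy
        rw [mem_erase, SimpleGraph.mem_neighborFinset] at hy
        refine ⟨h.split.mem_of_adj hv hy.2, hfar y hy.2, ?_⟩
        rw [← hEy y hy.2.ne' hy.1]; exact p.zero v hv hvr hvE y hy.2
      · intro w hw hwr hwX
        exact h3 w hw hwr (by simpa using hwX)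
      · intro w hw hwr hwX hCw y hwy
        have hwv : w ≠ v := by simpa using hwX
        obtain ⟨h1, h2⟩ := hz w hw hwr hwv hCw y hwy
        refine ⟨h1, h2, ?_⟩
        simp only [mem_erase, SimpleGraph.mem_neighborFinset]
        rintro ⟨-, hy⟩
        exact p.disj v hv hvr w hw hwr hwv.symm hvE
          (by rw [hEy w hwv (h.split.ne hw hxK)]; exact hCw) y hy hwy
      · intro w hw hwr hwX w' hw' hwr' hwX'
        exact hj w hw hwr (by simpa using hwX) w' hw' hwr' (by simpa using hwX')
      · have := card_le_card
          (sdiff_subset (s := leafSet G S r \ G.neighborFinset r)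
            (t := (G.neighborFinset v).erase x))
        omega
  push Not at hx
  have hv0 : ∀ x, G.Adj v x → C x = 0 := fun x hvx => by have := hx x hvx; omega
  by_cases hw : ∃ w ∈ S, w ≠ r ∧ w ≠ v ∧ 2 ≤ C w ∧ ∃ x, G.Adj v x ∧ G.Adj w x
  · obtain ⟨w, hw, hwr, hwv, hCw, x, hvx, hwx⟩ := hw
    obtain ⟨E, hE, p⟩ : ∃ E : V → ℕ, (∀ y, E y = C y - ((if y = v then 2 else 0) +
        if y = w then 2 else 0)) ∧ Quiet G S K r E :=
      ⟨_, fun _ => rfl, h.quiet_of_cone_cone hC hv hvr hw hwr hwv.symm hvx hwx (hfar x hvx)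
        (by omega) hCw⟩
    have hEv : E v = C v - 2 := by simp [hE, hwv.symm]
    have hEy : ∀ y, y ≠ v → y ≠ w → E y = C y := fun y hy hy' => by simp [hE, hy, hy']
    have hv5 := p.cone_le v hv hvr
    have hvE : 2 ≤ E v := by omega
    have hw3 := h3 w hw hwr hwv
    refine h.lt_of_six hd ⟨hv, hvr, hfar⟩ (Q := G.neighborFinset v ∪ G.neighborFinset w)
      subset_union_left ?_
    refine h.sum_le_of_root_zero (X := {v, w}) hA hr0 ?_ ?_ ?_ (fun y hy _ => hK y hy) ?_ ?_ ?_
    · simp only [mem_insert, mem_singleton]; rintro y (rfl | rfl) <;> omega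
    · rw [sum_pair hwv.symm]; omega
    · simp only [mem_union, SimpleGraph.mem_neighborFinset]
      rintro y (hy | hy)
      · exact ⟨h.split.mem_of_adj hv hy, hfar y hy, hv0 y hy⟩
      · exact ⟨h.split.mem_of_adj hw hy, hz w hw hwr hwv hCw y hy⟩
    · intro w' hw' hwr' hwX
      exact h3 w' hw' hwr' (by simp at hwX; exact hwX.1)
    · intro w' hw' hwr' hwX hCw' y hwy
      simp only [mem_insert, mem_singleton, not_or] at hwX
      obtain ⟨h1, h2⟩ := hz w' hw' hwr' hwX.1 hCw' y hwy
      refine ⟨h1, h2, ?_⟩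
      simp only [mem_union, SimpleGraph.mem_neighborFinset]
      rintro (hy | hy)
      · exact p.disj v hv hvr w' hw' hwr' (Ne.symm hwX.1) hvE
          (by rw [hEy w' hwX.1 hwX.2]; exact hCw') y hy hwy
      · exact hj w hw hwr hwv w' hw' hwr' hwX.1 (Ne.symm hwX.2) hCw hCw' y hy hwy
    · intro w hw hwr hwX w' hw' hwr' hwX'
      simp only [mem_insert, mem_singleton, not_or] at hwX hwX'
      exact hj w hw hwr hwX.1 w' hw' hwr' hwX'.1
  · push Not at hw
    refine h.lt_of_six hd ⟨hv, hvr, hfar⟩ (Q := G.neighborFinset v) subset_rfl ?_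
    refine h.sum_le_of_root_zero (X := {v}) hA hr0 ?_ ?_ ?_ (fun y hy _ => hK y hy) ?_ ?_ ?_
    · simp only [mem_singleton]; rintro y rfl; omega
    · rw [sum_singleton]; omega
    · simp only [SimpleGraph.mem_neighborFinset]
      exact fun y hy => ⟨h.split.mem_of_adj hv hy, hfar y hy, hv0 y hy⟩
    · intro w' hw' hwr' hwX
      exact h3 w' hw' hwr' (by simpa using hwX)
    · intro w' hw' hwr' hwX hCw' y hwy
      rw [mem_singleton] at hwX
      obtain ⟨h1, h2⟩ := hz w' hw' hwr' hwX hCw' y hwy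
      refine ⟨h1, h2, ?_⟩
      rw [SimpleGraph.mem_neighborFinset]
      exact fun hy => hw w' hw' hwr' hwX hCw' y hy hwy
    · intro w hw hwr hwX w' hw' hwr' hwX'
      rw [mem_singleton] at hwX hwX'
      exact hj w hw hwr hwX w' hw' hwr' hwX'

theorem sum_lt_of_cone_clique (hK : ∀ x ∈ K, C x ≤ 1) (hS : ∀ w ∈ S, w ≠ r → C w ≤ 3) {v x : V}
    (hv : v ∈ S) (hvr : v ≠ r) (hvx : G.Adj v x) (hCv : 2 ≤ C v) (hCx : 1 ≤ C x) :
    (∑ y, (C y : ℤ)) < tMax G S K r s + phoenixIndicator G S r := by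
  have hrx : ¬ G.Adj r x := fun hrx => by have := hA x hrx; omega
  have hr0 := apply_root_eq_zero hC
  have hxK := h.split.mem_of_adj hv hvx
  obtain ⟨D, hD, q⟩ : ∃ D : V → ℕ, (∀ y, D y = C y - ((if y = v then 2 else 0) +
      if y = x then 1 else 0)) ∧ Quiet G S K r D :=
    ⟨_, fun _ => rfl, h.quiet_of_cone_clique hC hv hvr hvx hrx hCv hCx⟩
  have hDw : ∀ w ∈ S, w ≠ v → D w = C w := fun w hw hwv => by
    simp [hD, hwv, h.split.ne hw hxK]
  have hDy : ∀ y ∈ K, y ≠ x → D y = C y := fun y hy hyx => by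
    simp [hD, (h.split.ne hv hy).symm, hyx]
  have hz : ∀ w ∈ S, w ≠ r → w ≠ v → 2 ≤ C w → ∀ y, G.Adj w y →
      ¬ G.Adj r y ∧ (y ≠ x → C y = 0) := by
    intro w hw hwr hwv hCw y hwy
    rw [← hDw w hw hwv] at hCw
    refine ⟨q.not_adj w hw hwr hCw y hwy, fun hyx => ?_⟩
    rw [← hDy y (h.split.mem_of_adj hw hwy) hyx]
    exact q.zero w hw hwr hCw y hwy
  have hj : ∀ w ∈ S, w ≠ r → w ≠ v → ∀ w' ∈ S, w' ≠ r → w' ≠ v → w ≠ w' → 2 ≤ C w → 2 ≤ C w' →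
      ∀ x, G.Adj w x → ¬ G.Adj w' x := by
    intro w hw hwr hwv w' hw' hwr' hwv' hne hCw hCw'
    rw [← hDw w hw hwv] at hCw
    rw [← hDw w' hw' hwv'] at hCw'
    exact q.disj w hw hwr w' hw' hwr' hne hCw hCw'
  have hv3 := hS v hv hvr
  by_cases hw : ∃ w ∈ S, w ≠ r ∧ w ≠ v ∧ 2 ≤ C w ∧ G.Adj w x
  · obtain ⟨w, hw, hwr, hwv, hCw, hwx⟩ := hw
    have hw3 := hS w hw hwr
    refine h.lt_of_four hd (q := #((G.neighborFinset w).erase x)) ?_ ?_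
    · rw [card_erase_add_one (by simpa using hwx), SimpleGraph.card_neighborFinset_eq_degree]
      exact h.farMinDegree_le ⟨hw, hwr, fun y hy => (hz w hw hwr hwv hCw y hy).1⟩
    · refine (h.sum_le_of_root_zero (X := {v, w}) (Q := (G.neighborFinset w).erase x) (e := 4)
        hA hr0 ?_ ?_ ?_ (fun y hy _ => hK y hy) (fun w hw hwr _ => hS w hw hwr) ?_ ?_).trans ?_
      · simp only [mem_insert, mem_singleton]; rintro y (rfl | rfl) <;> omega
      · rw [sum_pair hwv.symm]; omega
      · intro y hy
        rw [mem_erase, SimpleGraph.mem_neighborFinset] at hy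
        have := hz w hw hwr hwv hCw y hy.2
        exact ⟨h.split.mem_of_adj hw hy.2, this.1, this.2 hy.1⟩
      · intro w' hw' hwr' hwX hCw' y hwy
        simp only [mem_insert, mem_singleton, not_or] at hwX
        obtain ⟨h1, h2⟩ := hz w' hw' hwr' hwX.1 hCw' y hwy
        have hdj := hj w hw hwr hwv w' hw' hwr' hwX.1 (Ne.symm hwX.2) hCw hCw'
        refine ⟨h1, h2 (by rintro rfl; exact hdj y hwx hwy), ?_⟩
        simp only [mem_erase, SimpleGraph.mem_neighborFinset]
        exact fun hy => hdj y hy.2 hwy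
      · intro w hw hwr hwX w' hw' hwr' hwX'
        simp only [mem_insert, mem_singleton, not_or] at hwX hwX'
        exact hj w hw hwr hwX.1 w' hw' hwr' hwX'.1
      · have := card_le_card
          (sdiff_subset (s := leafSet G S r \ G.neighborFinset r)
            (t := (G.neighborFinset w).erase x))
        omega
  · push Not at hw
    refine h.lt_of_two hd ?_
    have := h.sum_le_of_root_zero (X := {v}) (Q := ∅) (e := 2)
      hA hr0 ?_ ?_ ?_ (fun y hy _ => hK y hy) (fun w hw hwr _ => hS w hw hwr) ?_ ?_
    · simpa using this
    · simp only [mem_singleton]; rintro y rfl; omega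
    · rw [sum_singleton]; omega
    · simp
    · intro w' hw' hwr' hwX hCw' y hwy
      rw [mem_singleton] at hwX
      obtain ⟨h1, h2⟩ := hz w' hw' hwr' hwX hCw' y hwy
      exact ⟨h1, h2 (by rintro rfl; exact hw w' hw' hwr' hwX hCw' hwy), by simp⟩
    · intro w hw hwr hwX w' hw' hwr' hwX'
      rw [mem_singleton] at hwX hwX'
      exact hj w hw hwr hwX w' hw' hwr' hwX'

variable (hK : ∀ x ∈ K, C x ≤ 1) (hS : ∀ w ∈ S, w ≠ r → C w ≤ 3)
  (hZ : ∀ w ∈ S, w ≠ r → 2 ≤ C w → ∀ x, G.Adj w x → C x = 0)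
include hK hS hZ

theorem sum_lt_of_star {u : V} (hu : u ∈ S) (hur : u ≠ r) (hCu : 2 ≤ C u)
    (hN : ∀ w ∈ S, w ≠ r → w ≠ u → 2 ≤ C w → ∀ y, G.Adj w y → ¬ G.Adj r y)
    (hD : ∀ w ∈ S, w ≠ r → w ≠ u → ∀ w' ∈ S, w' ≠ r → w' ≠ u → w ≠ w' → 2 ≤ C w → 2 ≤ C w' →
      ∀ x, G.Adj w x → ¬ G.Adj w' x) :
    (∑ y, (C y : ℤ)) < tMax G S K r s + phoenixIndicator G S r := by
  have hu3 := hS u hu hur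
  refine h.lt_of_two hd ?_
  have := h.sum_le_of_root_zero (X := {u}) (Q := ∅) (e := 2)
    hA (apply_root_eq_zero hC) ?_ ?_ ?_ (fun y hy _ => hK y hy) (fun w hw hwr _ => hS w hw hwr) ?_
    ?_
  · simpa using this
  · simp only [mem_singleton]; rintro y rfl; omega
  · rw [sum_singleton]; omega
  · simp
  · intro w hw hwr hwX hCw y hwy
    exact ⟨hN w hw hwr (by simpa using hwX) hCw y hwy, hZ w hw hwr hCw y hwy, by simp⟩
  · intro w hw hwr hwX w' hw' hwr' hwX'
    exact hD w hw hwr (by simpa using hwX) w' hw' hwr' (by simpa using hwX')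

theorem sum_lt_of_path {u v w x y : V} (hu : u ∈ S) (hur : u ≠ r) (hv : v ∈ S) (hvr : v ≠ r)
    (hw : w ∈ S) (hwr : w ≠ r) (huv : u ≠ v) (huw : u ≠ w) (hvw : v ≠ w) (hCu : 2 ≤ C u)
    (hCv : 2 ≤ C v) (hCw : 2 ≤ C w) (hux : G.Adj u x) (hvx : G.Adj v x) (hrx : ¬ G.Adj r x)
    (huy : G.Adj u y) (hwy : G.Adj w y) :
    (∑ y, (C y : ℤ)) < tMax G S K r s + phoenixIndicator G S r := by
  obtain ⟨f1, d1⟩ := h.disjoint_of_shared hC hu hur hv hvr huv hCu hCv hux hvx hrx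
  have hry := f1 w hw hwr huw.symm hvw.symm hCw y hwy
  obtain ⟨f2, d2⟩ := h.disjoint_of_shared hC hu hur hw hwr huw hCu hCw huy hwy hry
  have hfv := f2 v hv hvr huv.symm hvw hCv
  have hfw := f1 w hw hwr huw.symm hvw.symm hCw
  by_cases hz : ∃ z, G.Adj v z ∧ G.Adj w z
  · obtain ⟨z, hvz, hwz⟩ := hz
    obtain ⟨f3, d3⟩ := h.disjoint_of_shared hC hv hvr hw hwr hvw hCv hCw hvz hwz
      (hfv z hvz)
    have hfu := f3 u hu hur huv huw hCu
    refine h.lt_of_six hd ⟨hu, hur, hfu⟩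
      (Q := G.neighborFinset u ∪ (G.neighborFinset v ∪ G.neighborFinset w)) subset_union_left ?_
    have hu3 := hS u hu hur
    have hv3 := hS v hv hvr
    have hw3 := hS w hw hwr
    refine h.sum_le_of_root_zero (X := {u, v, w}) hA (apply_root_eq_zero hC) ?_ ?_ ?_
      (fun y hy _ => hK y hy) (fun w hw hwr _ => hS w hw hwr) ?_ ?_
    · simp only [mem_insert, mem_singleton]; rintro y (rfl | rfl | rfl) <;> omega
    · rw [sum_insert (by simp [huv, huw]), sum_pair hvw]; omega
    · simp only [mem_union, SimpleGraph.mem_neighborFinset]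
      rintro t (ht | ht | ht)
      · exact ⟨h.split.mem_of_adj hu ht, hfu t ht, hZ u hu hur hCu t ht⟩
      · exact ⟨h.split.mem_of_adj hv ht, hfv t ht, hZ v hv hvr hCv t ht⟩
      · exact ⟨h.split.mem_of_adj hw ht, hfw t ht, hZ w hw hwr hCw t ht⟩
    · intro w' hw' hwr' hwX hCw' t ht
      simp only [mem_insert, mem_singleton, not_or] at hwX
      obtain ⟨n1, n2, n3⟩ := hwX
      refine ⟨f1 w' hw' hwr' n1 n2 hCw' t ht, hZ w' hw' hwr' hCw' t ht, ?_⟩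
      simp only [mem_union, SimpleGraph.mem_neighborFinset]
      rintro (hy | hy | hy)
      · exact d3 u hu hur huv huw w' hw' hwr' n2 n3 (Ne.symm n1) hCu hCw' t hy ht
      · exact d2 v hv hvr huv.symm hvw w' hw' hwr' n1 n3 (Ne.symm n2) hCv hCw' t hy ht
      · exact d1 w hw hwr huw.symm hvw.symm w' hw' hwr' n1 n2 (Ne.symm n3) hCw hCw' t hy ht
    · intro a ha har haX b hb hbr hbX
      simp only [mem_insert, mem_singleton, not_or] at haX hbX
      exact d1 a ha har haX.1 haX.2.1 b hb hbr hbX.1 hbX.2.1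
  · push Not at hz
    refine h.sum_lt_of_star hd hC hA hK hS hZ hu hur hCu (fun a ha har hau hCa => ?_)
      (fun a ha har hau b hb hbr hbu hab hCa hCb t hat hbt => ?_)
    · by_cases hav : a = v
      · rw [hav]; exact hfv
      · exact f1 a ha har hau hav hCa
    · by_cases hav : a = v
      · subst hav
        by_cases hbw : b = w
        · subst hbw; exact hz t hat hbt
        · exact d2 a ha har hau hvw b hb hbr hbu hbw hab hCa hCb t hat hbt
      · by_cases hbv : b = v
        · subst hbv
          by_cases haw : a = w
          · subst haw; exact hz t hbt hat
          · exact d2 a ha har hau haw b hb hbr hbu hvw hab hCa hCb t hat hbt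
        · exact d1 a ha har hau hav b hb hbr hbu hbv hab hCa hCb t hat hbt

theorem sum_lt_of_cone_cone {u v x : V} (hu : u ∈ S) (hur : u ≠ r) (hv : v ∈ S) (hvr : v ≠ r)
    (huv : u ≠ v) (hCu : 2 ≤ C u) (hCv : 2 ≤ C v) (hux : G.Adj u x) (hvx : G.Adj v x)
    (hrx : ¬ G.Adj r x) :
    (∑ y, (C y : ℤ)) < tMax G S K r s + phoenixIndicator G S r := by
  obtain ⟨f1, d1⟩ := h.disjoint_of_shared hC hu hur hv hvr huv hCu hCv hux hvx hrx
  by_cases hwu : ∃ w ∈ S, w ≠ r ∧ u ≠ w ∧ v ≠ w ∧ 2 ≤ C w ∧ ∃ y, G.Adj u y ∧ G.Adj w y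
  · obtain ⟨w, hw, hwr, huw, hvw, hCw, y, huy, hwy⟩ := hwu
    exact h.sum_lt_of_path hd hC hA hK hS hZ hu hur hv hvr hw hwr huv huw hvw hCu hCv hCw hux hvx
      hrx huy hwy
  by_cases hwv : ∃ w ∈ S, w ≠ r ∧ u ≠ w ∧ v ≠ w ∧ 2 ≤ C w ∧ ∃ y, G.Adj v y ∧ G.Adj w y
  · obtain ⟨w, hw, hwr, huw, hvw, hCw, y, hvy, hwy⟩ := hwv
    exact h.sum_lt_of_path hd hC hA hK hS hZ hv hvr hu hur hw hwr huv.symm hvw huw hCv hCu hCw hvx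
      hux hrx hvy hwy
  push Not at hwu hwv
  by_cases hfv : ∀ y, G.Adj v y → ¬ G.Adj r y
  · refine h.sum_lt_of_star hd hC hA hK hS hZ hu hur hCu (fun a ha har hau hCa => ?_)
      (fun a ha har hau b hb hbr hbu hab hCa hCb t hat hbt => ?_)
    · by_cases hav : a = v
      · rw [hav]; exact hfv
      · exact f1 a ha har hau hav hCa
    · by_cases hav : a = v
      · subst hav
        exact hwv b hb hbr (Ne.symm hbu) hab hCb t hat hbt
      · by_cases hbv : b = v
        · subst hbv
          exact hwv a ha har (Ne.symm hau) (Ne.symm hab) hCa t hbt hat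
        · exact d1 a ha har hau hav b hb hbr hbu hbv hab hCa hCb t hat hbt
  by_cases hfu : ∀ y, G.Adj u y → ¬ G.Adj r y
  · refine h.sum_lt_of_star hd hC hA hK hS hZ hv hvr hCv (fun a ha har hav hCa => ?_)
      (fun a ha har hav b hb hbr hbv hab hCa hCb t hat hbt => ?_)
    · by_cases hau : a = u
      · rw [hau]; exact hfu
      · exact f1 a ha har hau hav hCa
    · by_cases hau : a = u
      · subst hau
        exact hwu b hb hbr hab (Ne.symm hbv) hCb t hat hbt
      · by_cases hbu : b = u
        · subst hbu
          exact hwu a ha har (Ne.symm hab) (Ne.symm hav) hCa t hbt hat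
        · exact d1 a ha har hau hav b hb hbr hbu hbv hab hCa hCb t hat hbt
  push Not at hfv hfu
  obtain ⟨b, hvb, hrb⟩ := hfv
  obtain ⟨a, hua, hra⟩ := hfu
  have hu3 := hS u hu hur
  have hv3 := hS v hv hvr
  refine h.lt_of_near_pair hd hu hur hv hvr hra hua hrb hvb ?_ hux hvx ?_
  · intro y hry huy hvy
    obtain ⟨z, hz⟩ := (h.feeds_of_cone hu hur huy).exists_lt hC hry (h.feeds_of_cone hv hvr hvy)
    simp only [Multiset.count_add, Multiset.count_singleton] at hz
    grind
  · refine (h.sum_le_of_root_zero (X := {u, v}) (e := 4)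
      (Q := (G.neighborFinset u ∪ G.neighborFinset v) \ G.neighborFinset r) hA
      (apply_root_eq_zero hC) ?_ ?_ ?_
      (fun y hy _ => hK y hy) (fun w hw hwr _ => hS w hw hwr) ?_ ?_).trans ?_
    · simp only [mem_insert, mem_singleton]; rintro y (rfl | rfl) <;> omega
    · rw [sum_pair huv]; omega
    · simp only [mem_sdiff, mem_union, SimpleGraph.mem_neighborFinset]
      rintro t ⟨ht | ht, hrt⟩
      · exact ⟨h.split.mem_of_adj hu ht, hrt, hZ u hu hur hCu t ht⟩
      · exact ⟨h.split.mem_of_adj hv ht, hrt, hZ v hv hvr hCv t ht⟩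
    · intro w hw hwr hwX hCw t ht
      simp only [mem_insert, mem_singleton, not_or] at hwX
      refine ⟨f1 w hw hwr hwX.1 hwX.2 hCw t ht, hZ w hw hwr hCw t ht, ?_⟩
      simp only [mem_sdiff, mem_union, SimpleGraph.mem_neighborFinset]
      rintro ⟨hy | hy, -⟩
      · exact hwu w hw hwr (Ne.symm hwX.1) (Ne.symm hwX.2) hCw t hy ht
      · exact hwv w hw hwr (Ne.symm hwX.1) (Ne.symm hwX.2) hCw t hy ht
    · intro a ha har haX b hb hbr hbX
      simp only [mem_insert, mem_singleton, not_or] at haX hbX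
      exact d1 a ha har haX.1 haX.2 b hb hbr hbX.1 hbX.2
    · have := card_le_card (sdiff_subset (s := leafSet G S r \ G.neighborFinset r)
        (t := (G.neighborFinset u ∪ G.neighborFinset v) \ G.neighborFinset r))
      omega

omit hA hK hS hZ in
theorem sum_lt_of_not_solvable :
    (∑ y, (C y : ℤ)) < tMax G S K r s + phoenixIndicator G S r := by
  by_cases hA : ∃ a, G.Adj r a ∧ 1 ≤ C a
  · obtain ⟨a, ha, hCa⟩ := hA
    exact h.sum_lt_of_pebbled hd hC ha hCa
  replace hA : ∀ a, G.Adj r a → C a = 0 := fun a ha => by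
    by_contra hne; exact hA ⟨a, ha, by omega⟩
  by_cases hK : ∃ x ∈ K, 2 ≤ C x
  · obtain ⟨x, hx, hCx⟩ := hK
    exact h.sum_lt_of_clique_pile hd hC hA hx hCx
  replace hK : ∀ x ∈ K, C x ≤ 1 := fun x hx => by
    by_contra hne; exact hK ⟨x, hx, by omega⟩
  by_cases hS : ∃ w ∈ S, w ≠ r ∧ 4 ≤ C w
  · obtain ⟨w, hw, hwr, hCw⟩ := hS
    exact h.sum_lt_of_cone_pile hd hC hA hK hw hwr hCw
  replace hS : ∀ w ∈ S, w ≠ r → C w ≤ 3 := fun w hw hwr => by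
    by_contra hne; exact hS ⟨w, hw, hwr, by omega⟩
  by_cases hZ : ∃ w ∈ S, w ≠ r ∧ 2 ≤ C w ∧ ∃ x, G.Adj w x ∧ 1 ≤ C x
  · obtain ⟨w, hw, hwr, hCw, x, hwx, hCx⟩ := hZ
    exact h.sum_lt_of_cone_clique hd hC hA hK hS hw hwr hwx hCw hCx
  replace hZ : ∀ w ∈ S, w ≠ r → 2 ≤ C w → ∀ x, G.Adj w x → C x = 0 := fun w hw hwr hCw x hwx => by
    by_contra hne; exact hZ ⟨w, hw, hwr, hCw, x, hwx, by omega⟩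
  by_cases hD : ∃ u ∈ S, u ≠ r ∧ ∃ v ∈ S, v ≠ r ∧ u ≠ v ∧ 2 ≤ C u ∧ 2 ≤ C v ∧
      ∃ x, G.Adj u x ∧ G.Adj v x ∧ ¬ G.Adj r x
  · obtain ⟨u, hu, hur, v, hv, hvr, huv, hCu, hCv, x, hux, hvx, hrx⟩ := hD
    exact h.sum_lt_of_cone_cone hd hC hA hK hS hZ hu hur hv hvr huv hCu hCv hux hvx hrx
  refine h.lt_of_card_leafSet hd ?_
  have := h.sum_add_card_le (C := C) (X := ∅) (Q := ∅) (apply_root_eq_zero hC) (by simp) (by simp)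
    (by simp) (fun x hx _ => hK x hx) (fun w hw hwr _ => hS w hw hwr)
    (fun w hw hwr _ hCw x hwx => ⟨hZ w hw hwr hCw x hwx, by simp⟩)
    (fun u hu hur _ v hv hvr _ huv hCu hCv x hux hvx => by
      by_cases hrx : G.Adj r x
      · obtain ⟨z, hz⟩ := (h.feeds_of_cone hu hur hux).exists_lt hC hrx
          (h.feeds_of_cone hv hvr hvx)
        simp only [Multiset.count_add, Multiset.count_singleton] at hz
        grind
      · exact hD ⟨u, hu, hur, v, hv, hvr, huv, hCu, hCv, x, hux, hvx, hrx⟩)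
  simp only [sum_empty, card_empty, sdiff_empty] at this
  push_cast at this
  linarith

end IsDeepRoot

end Upper

section Potential

open Finset

variable [DecidableEq V] {G : SimpleGraph V} {r : V}

theorem not_solvable_of_potential (Φ : (V → ℕ) → ℕ) {B : ℕ}
    (hΦ : ∀ (C C' : V → ℕ) (u v : V), G.Adj u v → 2 ≤ C u →
      (∀ y, C' y + (if y = u then 2 else 0) = C y + if y = v then 1 else 0) → Φ C' ≤ Φ C)
    (hr : ∀ C : V → ℕ, 1 ≤ C r → B ≤ Φ C) {C : V → ℕ} (hC : Φ C < B) : ¬ Solvable G r C := by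
  rintro ⟨D, hD, hDr⟩
  have : Φ D ≤ Φ C := by
    clear hDr
    induction hD with
    | refl => rfl
    | tail _ hstep ih =>
      obtain ⟨u, v, huv, hu, rfl⟩ := hstep
      refine (hΦ _ _ u v huv hu fun y => ?_).trans ih
      have := huv.ne
      by_cases hyv : y = v
      · subst hyv; simp [this.symm]
      · by_cases hyu : y = u
        · subst hyu; simp [hyv]; omega
        · simp [hyv, hyu]
  have := hr D hDr
  omega

/-- A potential bounded by transferring at most `d` from one index to another does not increase. -/
theorem sum_le_of_transfer [Fintype V] {F F' : V → ℕ} {i j : V} {d : ℕ}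
    (hF : ∀ z, F' z + (if z = i then d else 0) ≤ F z + if z = j then d else 0) :
    ∑ z, F' z ≤ ∑ z, F z := by
  have := sum_le_sum fun z (_ : z ∈ univ) => hF z
  simp only [sum_add_distrib, sum_ite_eq', mem_univ, if_true] at this
  omega

end Potential

section Hubs

open Finset

variable {G : SimpleGraph V} {S K : Set V} {r s : V} {H : Finset V} {k : ℕ}

/-- `H` is a set of cone vertices other than `r` with pairwise disjoint neighborhoods; these
avoid `N_r` if `k = 2`. -/
structure IsHubSet (G : SimpleGraph V) (S : Set V) (r : V) (H : Finset V) (k : ℕ) : Prop where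
  cone : ∀ h ∈ H, h ∈ S ∧ h ≠ r
  disj : ∀ h ∈ H, ∀ h' ∈ H, h ≠ h' → ∀ x, G.Adj h x → ¬ G.Adj h' x
  mode : k = 1 ∨ k = 2 ∧ ∀ h ∈ H, ∀ x, G.Adj h x → ¬ G.Adj r x

theorem IsHubSet.exists_representative (hS : IsSplitPartition G S K) (hH : IsHubSet G S r H k)
    (u : V) :
    ∃ i, ∀ z, z = i ↔ (z ∈ H ∧ (u = z ∨ G.Adj z u)) ∨
      (z ∉ H ∧ z = u ∧ ¬ ∃ h ∈ H, G.Adj h u) := by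
  by_cases hu : u ∈ H
  · refine ⟨u, fun z => ⟨?_, ?_⟩⟩
    · rintro rfl; exact .inl ⟨hu, .inl rfl⟩
    · rintro (⟨hz, rfl | hzu⟩ | ⟨-, rfl, -⟩)
      · rfl
      · exact absurd hzu (hS.indep (hH.cone z hz).1 (hH.cone u hu).1 hzu.ne)
      · rfl
  · by_cases hn : ∃ h ∈ H, G.Adj h u
    · obtain ⟨h, hh, hhu⟩ := hn
      refine ⟨h, fun z => ⟨?_, ?_⟩⟩
      · rintro rfl; exact .inl ⟨hh, .inr hhu⟩
      · rintro (⟨hz, rfl | hzu⟩ | ⟨-, rfl, hno⟩)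
        · exact absurd hz hu
        · by_contra hne; exact hH.disj z hz h hh hne u hzu hhu
        · exact absurd ⟨h, hh, hhu⟩ hno
    · refine ⟨u, fun z => ⟨?_, ?_⟩⟩
      · rintro rfl; exact .inr ⟨hu, rfl, hn⟩
      · rintro (⟨hz, rfl | hzu⟩ | ⟨-, rfl, hno⟩)
        · rfl
        · exact absurd ⟨z, hz, hzu⟩ hn
        · rfl

variable [Fintype V] [DecidableEq V] [DecidableRel G.Adj]

/-- The contribution of the vertex `z` to the potential of the configuration `C`; the pebbles on
the neighborhood of a hub are accounted for at the hub. -/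
noncomputable def hubWeight (G : SimpleGraph V) [DecidableRel G.Adj] (r : V) (H : Finset V)
    (k : ℕ) (C : V → ℕ) (z : V) : ℕ :=
  if z ∈ H then (∑ y ∈ G.neighborFinset z, C y + C z / 2) / 2
  else if ∃ h ∈ H, G.Adj h z then 0
  else if z = r then k * C z
  else if G.Adj r z then k * C z / 2
  else C z / 2

theorem IsHubSet.hubWeight_transfer (hS : IsSplitPartition G S K) (hr : r ∈ S)
    (hH : IsHubSet G S r H k) {C C' : V → ℕ} {u v i j : V} (huv : G.Adj u v) (hu : 2 ≤ C u)
    (hC : ∀ y, C' y + (if y = u then 2 else 0) = C y + if y = v then 1 else 0)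
    (hi : ∀ z, z = i ↔ (z ∈ H ∧ (u = z ∨ G.Adj z u)) ∨
      (z ∉ H ∧ z = u ∧ ¬ ∃ h ∈ H, G.Adj h u))
    (hj : ∀ z, z = j ↔ (z ∈ H ∧ (v = z ∨ G.Adj z v)) ∨
      (z ∉ H ∧ z = v ∧ ¬ ∃ h ∈ H, G.Adj h v)) (z : V) :
    hubWeight G r H k C' z + (if z = i then (if v = r then k else 1) else 0) ≤
      hubWeight G r H k C z + if z = j then (if v = r then k else 1) else 0 := by
  have hz := hC z
  have hne := huv.ne
  by_cases hzH : z ∈ H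
  · have hsum : ∑ y ∈ G.neighborFinset z, C' y + (if G.Adj z u then 2 else 0) =
        ∑ y ∈ G.neighborFinset z, C y + if G.Adj z v then 1 else 0 := by
      have := sum_congr (s₁ := G.neighborFinset z) rfl fun y _ => hC y
      simpa only [sum_add_distrib, sum_ite_eq', SimpleGraph.mem_neighborFinset] using this
    have hi' : z = i ↔ u = z ∨ G.Adj z u := by simp [hi, hzH]
    have hj' : z = j ↔ v = z ∨ G.Adj z v := by simp [hj, hzH]
    have hzr : ¬ G.Adj z r := fun hzr => hS.indep (hH.cone z hzH).1 hr hzr.ne hzr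
    have hzr' := (hH.cone z hzH).2
    simp only [hubWeight, if_pos hzH, hi', hj']
    by_cases huz : u = z
    · subst huz
      simp only [G.irrefl, huv, hne, hne.symm, if_true, if_false, or_true, true_or] at hsum hz ⊢
      omega
    · by_cases hvz : v = z
      · subst hvz
        simp only [G.irrefl, huv.symm, hne.symm, if_true, if_false, or_true, true_or] at hsum hz ⊢
        omega
      · simp only [huz, hvz, Ne.symm huz, Ne.symm hvz, if_false, false_or] at hz ⊢
        by_cases hzu : G.Adj z u
        · by_cases hzv : G.Adj z v
          · simp only [hzu, hzv, if_true] at hsum ⊢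
            omega
          · have hk : (if v = r then k else 1) = 1 := by
              split_ifs with hvr
              · subst hvr
                rcases hH.mode with h1 | ⟨-, h2⟩
                · exact h1
                · exact absurd huv.symm (h2 z hzH u hzu)
              · rfl
            simp only [hzu, hzv, if_true, if_false, hk] at hsum ⊢
            omega
        · by_cases hzv : G.Adj z v
          · have hvr : v ≠ r := by rintro rfl; exact hzr hzv
            simp only [hzu, hzv, hvr, if_true, if_false] at hsum ⊢
            omega
          · simp only [hzu, hzv, if_false] at hsum ⊢
            omega
  · by_cases hzN : ∃ h ∈ H, G.Adj h z
    · have hi' : ¬ z = i := by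
        rw [hi]; rintro (h1 | ⟨-, rfl, h2⟩)
        · exact hzH h1.1
        · exact h2 hzN
      simp [hubWeight, hzH, hzN, hi']
    · have hi' : z = i ↔ z = u := by
        rw [hi]; refine ⟨?_, ?_⟩
        · rintro (h1 | h1)
          · exact absurd h1.1 hzH
          · exact h1.2.1
        · rintro rfl; exact .inr ⟨hzH, rfl, hzN⟩
      have hj' : z = j ↔ z = v := by
        rw [hj]; refine ⟨?_, ?_⟩
        · rintro (h1 | h1)
          · exact absurd h1.1 hzH
          · exact h1.2.1
        · rintro rfl; exact .inr ⟨hzH, rfl, hzN⟩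
      simp only [hubWeight, if_neg hzH, if_neg hzN, hi', hj']
      have hk : k = 1 ∨ k = 2 := hH.mode.imp_right And.left
      by_cases huz : z = u
      · subst huz
        simp only [hne, if_true, if_false] at hz ⊢
        by_cases hvr : v = r
        · subst hvr
          simp only [hne, huv.symm, if_true, if_false]
          rcases hk with rfl | rfl <;> omega
        · simp only [hvr, if_false]
          rcases hk with rfl | rfl <;> split_ifs <;> omega
      · by_cases hvz : z = v
        · subst hvz
          simp only [huz, if_true, if_false] at hz ⊢
          rcases hk with rfl | rfl <;> split_ifs <;> omega
        · simp only [huz, hvz, if_false] at hz ⊢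
          have : C' z = C z := by omega
          rw [this]

/-- Three pebbles on each hub, none on the neighborhoods of hubs nor on `r` (nor on `N_r` if
`k = 2`), one pebble elsewhere, and `e` additional pebbles on `s`. -/
noncomputable def hubConfig (G : SimpleGraph V) [DecidableRel G.Adj] (r s : V) (H : Finset V)
    (k e : ℕ) (y : V) : ℕ :=
  (if y ∈ H then 3 else if y = r ∨ (∃ h ∈ H, G.Adj h y) ∨ k = 2 ∧ G.Adj r y then 0 else 1) +
    if y = s then e else 0

theorem IsHubSet.not_solvable (hS : IsSplitPartition G S K) (hr : r ∈ S)
    (hH : IsHubSet G S r H k) {e : ℕ}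
    (he : k = 1 ∧ e = 0 ∨ k = 2 ∧ IsFar G S r s ∧ (e = 2 ∨ e = 4 ∧ s ∈ H)) :
    ¬ Solvable G r (hubConfig G r s H k e) := by
  have hrH : r ∉ H := fun h => (hH.cone r h).2 rfl
  have hrN : ¬ ∃ h ∈ H, G.Adj h r := by
    rintro ⟨h, hh, hhr⟩
    exact hS.indep (hH.cone h hh).1 hr hhr.ne hhr
  refine not_solvable_of_potential (fun C => ∑ z, hubWeight G r H k C z) (B := k) ?_ ?_ ?_
  · intro C C' u v huv hu hC
    obtain ⟨i, hi⟩ := hH.exists_representative hS u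
    obtain ⟨j, hj⟩ := hH.exists_representative hS v
    exact sum_le_of_transfer (hH.hubWeight_transfer hS hr huv hu hC hi hj)
  · intro C hCr
    refine le_trans ?_ (single_le_sum (fun _ _ => Nat.zero_le _) (mem_univ r))
    simp only [hubWeight, hrH, hrN, if_true, if_false]
    exact Nat.le_mul_of_pos_right _ hCr
  · have hk : k = 1 ∨ k = 2 := hH.mode.imp_right And.left
    have hpt : ∀ z, hubWeight G r H k (hubConfig G r s H k e) z ≤ if z = s then k - 1 else 0 := by
      intro z
      by_cases hzH : z ∈ H
      · have h0 : ∑ y ∈ G.neighborFinset z, hubConfig G r s H k e y = 0 := by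
          refine sum_eq_zero fun y hy => ?_
          rw [SimpleGraph.mem_neighborFinset] at hy
          have hyK := hS.mem_of_adj (hH.cone z hzH).1 hy
          have hyH : y ∉ H := fun h => hS.not_mem_right (hH.cone y h).1 hyK
          have hex : ∃ h ∈ H, G.Adj h y := ⟨z, hzH, hy⟩
          rcases he with ⟨-, rfl⟩ | ⟨-, hs, -⟩
          · simp [hubConfig, hyH, hex]
          · simp [hubConfig, hyH, hex, (hS.ne hs.1 hyK).symm]
        have hz : hubConfig G r s H k e z = 3 + if z = s then e else 0 := by
          simp [hubConfig, hzH]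
        simp only [hubWeight, hzH, if_true, h0, hz]
        split_ifs <;> omega
      · by_cases hzN : ∃ h ∈ H, G.Adj h z
        · simp [hubWeight, hzH, hzN]
        · simp only [hubWeight, hzH, hzN, if_false, hubConfig, false_or]
          by_cases hzs : z = s
          · subst hzs
            rcases he with ⟨rfl, rfl⟩ | ⟨rfl, hs, h3⟩
            · simp; split_ifs <;> omega
            · have h2 : e = 2 := h3.resolve_right fun h => hzH h.2
              have hzr : ¬ G.Adj r z := fun h => hS.indep hr hs.1 h.ne h
              simp [hs.2.1, hzr, h2]
          · rcases hk with rfl | rfl <;> simp only [hzs, if_false] <;> split_ifs <;>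
              simp_all
    calc ∑ z, hubWeight G r H k (hubConfig G r s H k e) z
        ≤ ∑ z, if z = s then k - 1 else 0 := sum_le_sum fun z _ => hpt z
      _ = k - 1 := by simp
      _ < k := by omega

theorem IsHubSet.card_le_sum (hH : IsHubSet G S r H k) (e : ℕ) :
    (Fintype.card V : ℤ) + ∑ h ∈ H, (2 - (G.degree h : ℤ)) + e -
      (if k = 2 then (G.degree r : ℤ) else 0) ≤ ∑ y, (hubConfig G r s H k e y : ℤ) + 1 := by
  classical
  set A : Finset V := if k = 2 then G.neighborFinset r else ∅ with hA
  set N : Finset V := H.biUnion fun h => G.neighborFinset h with hN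
  have mA : ∀ {y}, y ∈ A ↔ k = 2 ∧ G.Adj r y := by
    intro y; rw [hA]; split_ifs with hk <;> simp [hk]
  have mN : ∀ {y}, y ∈ N ↔ ∃ h ∈ H, G.Adj h y := by simp [hN]
  have pt : ∀ y, (1 : ℤ) + (if y ∈ H then 2 else 0) - (if y = r then 1 else 0) -
      (if y ∈ N then 1 else 0) - (if y ∈ A then 1 else 0) + (if y = s then (e : ℤ) else 0) ≤
      (hubConfig G r s H k e y : ℤ) := by
    intro y
    have hHy : y ∈ H → y ≠ r := fun hy => (hH.cone y hy).2
    simp only [hubConfig, ← mN, ← mA]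
    push_cast
    split_ifs <;> first | omega | (exfalso; tauto)
  have tot := sum_le_sum fun y (_ : y ∈ univ) => pt y
  have cN : #N ≤ ∑ h ∈ H, G.degree h := card_biUnion_le
  have cA : (#A : ℤ) = if k = 2 then (G.degree r : ℤ) else 0 := by
    rw [hA]; split_ifs <;> simp
  rw [← cA]
  simp only [sum_sub_distrib, sum_add_distrib, sum_ite_mem, univ_inter, sum_ite_eq', mem_univ,
    if_true, sum_const, card_univ, nsmul_eq_mul, mul_one] at tot ⊢
  have cN' : (#N : ℤ) ≤ ∑ h ∈ H, (G.degree h : ℤ) := by exact_mod_cast cN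
  linarith

end Hubs

/-- The combined weight of the piles on `p` and `a` changes by at most the transferred amount. -/
theorem pile_transfer [DecidableEq V] {p a u v : V} {C C' : V → ℕ} {d : ℕ} (hpa : p ≠ a) (huv : u ≠ v)
    (hC : ∀ y, C' y + (if y = u then 2 else 0) = C y + if y = v then 1 else 0) (hd : d ≤ 3)
    (hp : u = p → v ≠ a → d ≤ 1) (hv : v = p ∨ v = a → ¬ (u = p ∨ u = a) → 2 ≤ d) :
    (C' p / 2 + C' a) + (C' p / 2 + C' a) / 2 + (if u = p ∨ u = a then d else 0) ≤
      (C p / 2 + C a) + (C p / 2 + C a) / 2 + if v = p ∨ v = a then d else 0 := by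
  have h1 := hC p
  have h2 := hC a
  have hap := hpa.symm
  clear hC
  by_cases up : u = p
  · subst up
    by_cases va : v = a
    · subst va
      simp only [hpa, hap, if_true, if_false, true_or, or_true] at h1 h2 ⊢
      omega
    · have := hp rfl va
      simp only [huv, huv.symm, hap, va, Ne.symm va, if_true, if_false, true_or, or_self]
        at h1 h2 ⊢
      omega
  · by_cases ua : u = a
    · subst ua
      by_cases vp : v = p
      · subst vp
        simp only [hpa, hap, if_true, if_false, true_or, or_true] at h1 h2 ⊢
        omega
      · simp only [huv, huv.symm, hpa, vp, Ne.symm vp, if_true, if_false, or_true, or_self]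
          at h1 h2 ⊢
        omega
    · simp only [up, ua, Ne.symm up, Ne.symm ua, or_self, if_false] at h1 h2 hv ⊢
      by_cases vp : v = p
      · subst vp
        have := hv (.inl rfl) not_false
        simp only [hap, if_true, if_false, true_or] at h1 h2 ⊢
        omega
      · by_cases va : v = a
        · subst va
          have := hv (.inr rfl) not_false
          simp only [hpa, if_true, if_false, or_true] at h1 h2 ⊢
          omega
        · simp only [vp, va, Ne.symm vp, Ne.symm va, or_self, if_false] at h1 h2 ⊢
          rw [show C' p = C p by omega, show C' a = C a by omega]

section Lower

open Finset

variable [Fintype V] [DecidableEq V] {G : SimpleGraph V} [DecidableRel G.Adj] {S K : Set V}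
  {r s : V}

namespace IsDeepRoot

variable (h : IsDeepRoot G S K r)
include h

theorem exists_leaves (P : Finset V) (hP : ∀ x ∈ P, IsCutVertex G x) :
    ∃ L : Finset V, (∀ l ∈ L, l ∈ S ∧ ∃ x ∈ P, ∀ y, G.Adj l y ↔ y = x) ∧
      (∀ l ∈ L, ∀ l' ∈ L, l ≠ l' → ∀ x, G.Adj l x → ¬ G.Adj l' x) ∧
      ∑ l ∈ L, (2 - (G.degree l : ℤ)) = #P := by
  classical
  have : ∀ x, ∃ l, x ∈ P → l ∈ S ∧ ∀ y, G.Adj l y ↔ y = x := by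
    intro x
    by_cases hx : x ∈ P
    · obtain ⟨l, hl, hlx⟩ := h.isCutVertex_iff.1 (hP x hx)
      exact ⟨l, fun _ => ⟨hl, fun y => by rw [← SimpleGraph.mem_neighborSet, hlx]; rfl⟩⟩
    · exact ⟨x, fun hx' => absurd hx' hx⟩
  choose f hf using this
  have hinj : Set.InjOn f P := by
    intro x hx y hy hxy
    have := ((hf x hx).2 x).2 rfl
    rw [hxy] at this
    exact ((hf y hy).2 x).1 this
  refine ⟨P.image f, ?_, ?_, ?_⟩
  · simp only [mem_image]
    rintro l ⟨x, hx, rfl⟩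
    exact ⟨(hf x hx).1, x, hx, (hf x hx).2⟩
  · simp only [mem_image]
    rintro l ⟨x, hx, rfl⟩ l' ⟨y, hy, rfl⟩ hne z hz hz'
    rw [(hf x hx).2] at hz
    rw [(hf y hy).2] at hz'
    exact hne (by rw [← hz, hz'])
  · rw [sum_image hinj, card_eq_sum_ones, Nat.cast_sum]
    refine sum_congr rfl fun x hx => ?_
    have : G.degree (f x) = 1 := by
      rw [← SimpleGraph.card_neighborFinset_eq_degree, card_eq_one]
      exact ⟨x, by ext y; simp [(hf x hx).2]⟩
    rw [this]; norm_num

theorem exists_config_tRS_tR (hs : IsFar G S r s) :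
    (∃ C, ¬ Solvable G r C ∧ tRS G K r s ≤ ∑ y, (C y : ℤ) + 1) ∧
    ∃ C, ¬ Solvable G r C ∧ tR G K r s ≤ ∑ y, (C y : ℤ) + 1 := by
  classical
  obtain ⟨L, hL, hLd, hLs⟩ := h.exists_leaves
    (univ.filter fun x => x ∈ K ∧ IsCutVertex G x ∧ ¬ G.Adj r x ∧ ¬ G.Adj s x)
    (fun x hx => (mem_filter.1 hx).2.2.1)
  simp only [mem_filter, mem_univ, true_and] at hL
  have hc : (#(univ.filter fun x => x ∈ K ∧ IsCutVertex G x ∧ ¬ G.Adj r x ∧ ¬ G.Adj s x) : ℤ) =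
      cutRS G K r s := by
    rw [cutRS, ← Set.ncard_coe_finset]; simp
  rw [hc] at hLs
  have hLr : ∀ l ∈ L, ∀ x, G.Adj l x → ¬ G.Adj r x ∧ ¬ G.Adj s x := by
    intro l hl x hx
    obtain ⟨-, z, hz, hlz⟩ := hL l hl
    rw [hlz] at hx; subst hx
    exact hz.2.2
  have hne : ∀ l ∈ L, l ≠ r ∧ l ≠ s := by
    intro l hl
    obtain ⟨x, hx⟩ := h.exists_adj l
    have := hLr l hl x hx
    exact ⟨by rintro rfl; exact this.1 hx, by rintro rfl; exact this.2 hx⟩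
  have H1 : IsHubSet G S r L 2 :=
    ⟨fun l hl => ⟨(hL l hl).1, (hne l hl).1⟩, hLd, .inr ⟨rfl, fun l hl x hx => (hLr l hl x hx).1⟩⟩
  have H2 : IsHubSet G S r (insert s L) 2 := by
    refine ⟨?_, ?_, .inr ⟨rfl, ?_⟩⟩
    · simp only [mem_insert]; rintro l (rfl | hl)
      · exact ⟨hs.1, hs.2.1⟩
      · exact H1.cone l hl
    · simp only [mem_insert]
      rintro l (rfl | hl) l' (rfl | hl') hll x hx hx'
      · exact hll rfl
      · exact (hLr l' hl' x hx').2 hx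
      · exact (hLr l hl x hx).2 hx'
      · exact hLd l hl l' hl' hll x hx hx'
    · simp only [mem_insert]; rintro l (rfl | hl)
      · exact hs.2.2
      · exact fun x hx => (hLr l hl x hx).1
  have hsL : s ∉ L := fun hsL => (hne s hsL).2 rfl
  refine ⟨⟨_, H2.not_solvable h.split h.mem
    (.inr ⟨rfl, hs, .inr ⟨rfl, mem_insert_self _ _⟩⟩), ?_⟩,
    ⟨_, H1.not_solvable h.split h.mem (.inr ⟨rfl, hs, .inl rfl⟩), ?_⟩⟩
  · refine le_trans ?_ (H2.card_le_sum 4)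
    rw [sum_insert hsL, hLs, if_pos rfl, tRS]
    push_cast; linarith
  · refine le_trans ?_ (H1.card_le_sum 2)
    rw [hLs, if_pos rfl, tR]
    push_cast; linarith

theorem exists_config_tS_tZero (hs : IsFar G S r s) (hr : 2 ≤ G.degree r) :
    (∃ C, ¬ Solvable G r C ∧ tS G S K r s ≤ ∑ y, (C y : ℤ) + 1) ∧
    ∃ C, ¬ Solvable G r C ∧ tZero G S K r s ≤ ∑ y, (C y : ℤ) + 1 := by
  classical
  set P := univ.filter fun x => x ∈ K ∧ IsCutVertex G x ∧ ¬ G.Adj r x ∧ ¬ G.Adj s x with hP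
  set Q := univ.filter fun x => IsCutVertex G x ∧ G.Adj r x ∧ ∃ v ∈ S, v ≠ r ∧ G.Adj v x with hQ
  have mP : ∀ {x}, x ∈ P ↔ x ∈ K ∧ IsCutVertex G x ∧ ¬ G.Adj r x ∧ ¬ G.Adj s x := by simp [hP]
  have mQ : ∀ {x}, x ∈ Q ↔ IsCutVertex G x ∧ G.Adj r x ∧ ∃ v ∈ S, v ≠ r ∧ G.Adj v x := by
    simp [hQ]
  obtain ⟨L, hL, hLd, hLs⟩ := h.exists_leaves (P ∪ Q) (fun x hx => by
    rcases mem_union.1 hx with hx | hx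
    · exact (mP.1 hx).2.1
    · exact (mQ.1 hx).1)
  have hc : (#P : ℤ) = cutRS G K r s := by
    rw [cutRS, hP, ← Set.ncard_coe_finset]; simp
  have hc' : (#Q : ℤ) = cutR0 G S r := by
    rw [cutR0, hQ, ← Set.ncard_coe_finset]; simp
  have hPQ : Disjoint P Q := by
    rw [disjoint_left]; intro x hx hx'
    exact (mP.1 hx).2.2.1 (mQ.1 hx').2.1
  rw [card_union_of_disjoint hPQ, Nat.cast_add, hc, hc'] at hLs
  have hLx : ∀ l ∈ L, ∀ x, G.Adj l x → ¬ G.Adj s x := by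
    intro l hl x hx
    obtain ⟨-, z, hz, hlz⟩ := hL l hl
    rw [hlz] at hx; subst hx
    rcases mem_union.1 hz with hz | hz
    · exact (mP.1 hz).2.2.2
    · exact fun hsx => hs.2.2 x hsx (mQ.1 hz).2.1
  have hne : ∀ l ∈ L, l ≠ r ∧ l ≠ s := by
    intro l hl
    refine ⟨?_, ?_⟩
    · rintro rfl
      obtain ⟨-, z, hz, hlz⟩ := hL l hl
      have : #(G.neighborFinset l) ≤ 1 := card_le_one.2 fun a ha b hb => by
        rw [SimpleGraph.mem_neighborFinset, hlz] at ha hb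
        rw [ha, hb]
      rw [SimpleGraph.card_neighborFinset_eq_degree] at this
      omega
    · rintro rfl
      obtain ⟨x, hx⟩ := h.exists_adj l
      exact hLx l hl x hx hx
  have H1 : IsHubSet G S r L 1 :=
    ⟨fun l hl => ⟨(hL l hl).1, (hne l hl).1⟩, hLd, .inl rfl⟩
  have H2 : IsHubSet G S r (insert s L) 1 := by
    refine ⟨?_, ?_, .inl rfl⟩
    · simp only [mem_insert]; rintro l (rfl | hl)
      · exact ⟨hs.1, hs.2.1⟩
      · exact H1.cone l hl
    · simp only [mem_insert]
      rintro l (rfl | hl) l' (rfl | hl') hll x hx hx'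
      · exact hll rfl
      · exact hLx l' hl' x hx' hx
      · exact hLx l hl x hx hx'
      · exact hLd l hl l' hl' hll x hx hx'
  have hsL : s ∉ L := fun hsL => (hne s hsL).2 rfl
  refine ⟨⟨_, H2.not_solvable (s := s) h.split h.mem (.inl ⟨rfl, rfl⟩), ?_⟩,
    ⟨_, H1.not_solvable (s := s) h.split h.mem (.inl ⟨rfl, rfl⟩), ?_⟩⟩
  · refine le_trans ?_ (H2.card_le_sum 0)
    rw [sum_insert hsL, hLs, if_neg (by norm_num), tS]
    push_cast; linarith
  · refine le_trans ?_ (H1.card_le_sum 0)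
    rw [hLs, if_neg (by norm_num), tZero]
    push_cast; linarith

theorem exists_config_tMax (hs : IsFar G S r s) :
    ∃ C, ¬ Solvable G r C ∧ tMax G S K r s ≤ ∑ y, (C y : ℤ) + 1 := by
  obtain ⟨⟨C₁, n₁, h₁⟩, C₂, n₂, h₂⟩ := h.exists_config_tRS_tR hs
  have key : tMax G S K r s ≤ tRS G K r s ∨ tMax G S K r s ≤ tR G K r s ∨ 2 ≤ G.degree r ∧
      (tMax G S K r s ≤ tS G S K r s ∨ tMax G S K r s ≤ tZero G S K r s) := by
    by_cases hd : 2 ≤ G.degree r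
    · simp only [tMax]; omega
    · have h1 : cutR0 G S r ≤ 1 := by
        have : {x : V | IsCutVertex G x ∧ G.Adj r x ∧ ∃ v ∈ S, v ≠ r ∧ G.Adj v x}.ncard ≤
            #(G.neighborFinset r) := by
          rw [← Set.ncard_coe_finset]
          refine Set.ncard_le_ncard (fun x hx => ?_) (Set.toFinite _)
          simpa using hx.2.1
        rw [SimpleGraph.card_neighborFinset_eq_degree] at this
        unfold cutR0
        omega
      have h2 : tS G S K r s ≤ tRS G K r s := by simp only [tS, tRS]; omega
      have h3 : tZero G S K r s ≤ tR G K r s := by simp only [tZero, tR]; omega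
      simp only [tMax]; omega
  rcases key with hk | hk | ⟨hd, hk⟩
  · exact ⟨C₁, n₁, hk.trans h₁⟩
  · exact ⟨C₂, n₂, hk.trans h₂⟩
  · obtain ⟨⟨C₃, n₃, h₃⟩, C₄, n₄, h₄⟩ := h.exists_config_tS_tZero hs hd
    rcases hk with hk | hk
    · exact ⟨C₃, n₃, hk.trans h₃⟩
    · exact ⟨C₄, n₄, hk.trans h₄⟩

theorem tMax_le_card_of_isPhoenix (hd : G.degree s = farMinDegree G r) (hph : IsPhoenix G S r) :
    tMax G S K r s ≤ Fintype.card V := by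
  obtain ⟨⟨p, hp, q, hq, a, b, c, -, hab, -, -, hNr, -, -, hcut⟩, -, h4⟩ := hph
  have hr2 : G.degree r = 2 := by
    rw [← SimpleGraph.card_neighborFinset_eq_degree, ← card_pair hab]
    congr 1
    rw [← coe_inj, SimpleGraph.coe_neighborFinset, hNr]; simp
  have h0 : cutR0 G S r = 0 := by
    rw [cutR0, Nat.cast_eq_zero, Set.ncard_eq_zero (Set.toFinite _), Set.eq_empty_iff_forall_notMem]
    rintro x ⟨hx, hrx, -⟩
    rw [← SimpleGraph.mem_neighborSet, hNr] at hrx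
    refine hcut x ?_ hx
    rcases hrx with rfl | rfl <;> simp
  have h1 : cutRS G K r s = 0 := by
    rw [cutRS, Nat.cast_eq_zero, Set.ncard_eq_zero (Set.toFinite _), Set.eq_empty_iff_forall_notMem]
    rintro x ⟨-, hx, hrx, -⟩
    obtain ⟨l, hl, hlx⟩ := h.isCutVertex_iff.1 hx
    have := h.farMinDegree_eq_one_of_hasLeaf ⟨l, hl, ?_, hlx⟩ hrx
    · omega
    · rintro rfl
      apply hrx
      rw [← SimpleGraph.mem_neighborSet, hlx]; rfl
  simp only [tMax, tRS, tR, tS, tZero]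
  omega

end IsDeepRoot

/-- The potential used for the Phoenix configuration: the piles on `p` and `a`, and those on `q`
and `b`, are accounted for together. -/
def phoenixWeight (r p q a b c : V) (C : V → ℕ) (z : V) : ℕ :=
  if z = p then (C p / 2 + C a) + (C p / 2 + C a) / 2
  else if z = q then (C q / 2 + C b) + (C q / 2 + C b) / 2
  else if z = a ∨ z = b then 0
  else if z = c then C z
  else if z = r then 3 * C z
  else 2 * (C z / 2)

/-- Three pebbles on `p` and `q`, none on `r`, `a`, `b`, `c`, and one elsewhere. -/
def phoenixConfig (r p q a b c : V) (y : V) : ℕ :=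
  if y = p ∨ y = q then 3 else if y = r ∨ y = a ∨ y = b ∨ y = c then 0 else 1

omit [DecidableRel G.Adj] in
theorem phoenixConfig_not_solvable {p q a b c : V}
    (hd : [r, p, q, a, b, c].Nodup) (hr : ∀ y, G.Adj r y ↔ y = a ∨ y = b)
    (hp : ∀ y, G.Adj p y ↔ y = a ∨ y = c) (hq : ∀ y, G.Adj q y ↔ y = b ∨ y = c) :
    ¬ Solvable G r (phoenixConfig r p q a b c) := by
  simp only [List.nodup_cons, List.mem_cons, List.not_mem_nil, or_false, not_or,
    List.nodup_nil, and_true, not_false_eq_true] at hd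
  obtain ⟨⟨rp, rq, ra, rb, rc⟩, ⟨pq, pa, pb, pc⟩, ⟨qa, qb, qc⟩, ⟨ab, ac⟩, bc⟩ := hd
  refine not_solvable_of_potential (fun C => ∑ z, phoenixWeight r p q a b c C z) (B := 3) ?_ ?_ ?_
  · intro C C' u v huv hu hC
    have hne := huv.ne
    have hur : v = r → u = a ∨ u = b := fun e => (hr u).1 (e ▸ huv.symm)
    have hru : u = r → v = a ∨ v = b := fun e => (hr v).1 (e ▸ huv)
    have hup : v = p → u = a ∨ u = c := fun e => (hp u).1 (e ▸ huv.symm)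
    have hpu : u = p → v = a ∨ v = c := fun e => (hp v).1 (e ▸ huv)
    have huq : v = q → u = b ∨ u = c := fun e => (hq u).1 (e ▸ huv.symm)
    have hqu : u = q → v = b ∨ v = c := fun e => (hq v).1 (e ▸ huv)
    clear hr hp hq
    obtain ⟨d, d1, d2, d3⟩ : ∃ d : ℕ, (v = r → d = 3) ∧ (v ≠ r → u = p ∨ u = q → d = 1) ∧
        (v ≠ r → u ≠ p → u ≠ q → d = 2) := by
      refine ⟨if v = r then 3 else if u = p ∨ u = q then 1 else 2, ?_, ?_, ?_⟩
      · intro e; simp [e]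
      · intro e e'; simp [e, e']
      · intro e e' e''; simp [e, e', e'']
    have d0 : 1 ≤ d ∧ d ≤ 3 := by
      by_cases e : v = r
      · have := d1 e; omega
      · by_cases e' : u = p ∨ u = q
        · have := d2 e e'; omega
        · push Not at e'
          have := d3 e e'.1 e'.2; omega
    refine sum_le_of_transfer (i := if u = a then p else if u = b then q else u)
      (j := if v = a then p else if v = b then q else v) (d := d) fun z => ?_
    unfold phoenixWeight
    by_cases zp : z = p
    · have hi : z = (if u = a then p else if u = b then q else u) ↔ u = p ∨ u = a := by
        clear d0 d1 d2 d3 hC; grind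
      have hj : z = (if v = a then p else if v = b then q else v) ↔ v = p ∨ v = a := by
        clear d0 d1 d2 d3 hC; grind
      simp only [hi, hj, if_pos zp]
      refine pile_transfer pa hne hC d0.2 (fun e e' => ?_) (fun e e' => ?_)
      · refine (d2 ?_ (.inl e)).le
        rintro rfl; exact (hpu e).elim e' rc
      · refine (d3 ?_ ?_ ?_).ge
        · rintro rfl; exact e.elim rp ra
        · exact fun e'' => e' (.inl e'')
        · intro e''; clear hC; grind
    by_cases zq : z = q
    · have hi : z = (if u = a then p else if u = b then q else u) ↔ u = q ∨ u = b := by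
        clear d0 d1 d2 d3 hC; grind
      have hj : z = (if v = a then p else if v = b then q else v) ↔ v = q ∨ v = b := by
        clear d0 d1 d2 d3 hC; grind
      simp only [hi, hj, if_neg zp, if_pos zq]
      refine pile_transfer qb hne hC d0.2 (fun e e' => ?_) (fun e e' => ?_)
      · refine (d2 ?_ (.inr e)).le
        rintro rfl; exact (hqu e).elim e' rc
      · refine (d3 ?_ ?_ ?_).ge
        · rintro rfl; exact e.elim rq rb
        · intro e''; clear hC; grind
        · exact fun e'' => e' (.inl e'')
    have hz := hC z
    clear hC
    by_cases zab : z = a ∨ z = b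
    · have hi : ¬ z = (if u = a then p else if u = b then q else u) := by
        clear d0 d1 d2 d3 hz; grind
      simp only [hi, if_neg zp, if_neg zq, if_pos zab, if_false]
      omega
    have hi : z = (if u = a then p else if u = b then q else u) ↔ z = u := by
      clear d0 d1 d2 d3 hz; grind
    have hj : z = (if v = a then p else if v = b then q else v) ↔ z = v := by
      clear d0 d1 d2 d3 hz; grind
    simp only [hi, hj, if_neg zp, if_neg zq, if_neg zab]
    clear hi hj
    by_cases zu : z = u
    · subst zu
      simp only [hne, if_true, if_false] at hz ⊢
      have hd : z ≠ r → d ≤ 2 := fun e => by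
        by_cases hvr : v = r
        · exact absurd (hur hvr) zab
        · exact (d3 hvr zp zq).le
      by_cases zr : z = r
      · have := Ne.symm rc
        rw [zr] at hz ⊢; simp only [rc, if_false, if_true]; omega
      · have := hd zr
        simp only [zr, if_false]; split_ifs <;> omega
    · by_cases zv : z = v
      · subst zv
        simp only [zu, if_true, if_false] at hz ⊢
        by_cases zc : z = c
        · simp only [if_pos zc]; omega
        · by_cases zr : z = r
          · have := d1 zr
            simp only [if_neg zc, if_pos zr]; omega
          · have : d = 2 := d3 zr (fun e => (hpu e).elim (fun e => zab (.inl e)) zc)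
              (fun e => (hqu e).elim (fun e => zab (.inr e)) zc)
            simp only [if_neg zc, if_neg zr]; omega
      · simp only [zu, zv, if_false] at hz ⊢
        have : C' z = C z := by omega
        rw [this]
  · intro C hCr
    refine le_trans ?_ (single_le_sum (fun _ _ => Nat.zero_le _) (mem_univ r))
    simp only [phoenixWeight, rp, rq, ra, rb, rc, if_false, or_self, if_true]
    omega
  · have hpt : ∀ z, phoenixWeight r p q a b c (phoenixConfig r p q a b c) z ≤
        (if z = p then 1 else 0) + if z = q then 1 else 0 := by
      intro z
      have e1 : phoenixConfig r p q a b c p = 3 := by simp [phoenixConfig]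
      have e2 : phoenixConfig r p q a b c q = 3 := by simp [phoenixConfig]
      have e3 : phoenixConfig r p q a b c a = 0 := by
        simp [phoenixConfig, Ne.symm pa, Ne.symm qa]
      have e4 : phoenixConfig r p q a b c b = 0 := by
        simp [phoenixConfig, Ne.symm pb, Ne.symm qb]
      unfold phoenixWeight
      rw [e1, e2, e3, e4]
      unfold phoenixConfig
      split_ifs <;> first | omega | simp_all
    have := sum_le_sum fun z (_ : z ∈ univ) => hpt z
    simp only [sum_add_distrib, sum_ite_eq', mem_univ, if_true] at this
    omega

theorem card_le_sum_phoenixConfig {p q a b c : V} (hpq : p ≠ q) :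
    (Fintype.card V : ℤ) ≤ ∑ y, (phoenixConfig r p q a b c y : ℤ) := by
  have pt : ∀ y, (1 : ℤ) + (if y = p then 2 else 0) + (if y = q then 2 else 0) -
      (if y = r then 1 else 0) - (if y = a then 1 else 0) - (if y = b then 1 else 0) -
      (if y = c then 1 else 0) ≤ (phoenixConfig r p q a b c y : ℤ) := by
    intro y
    unfold phoenixConfig
    push_cast
    by_cases h1 : y = p
    · subst h1
      simp only [hpq, if_true, if_false, true_or]; split_ifs <;> omega
    · by_cases h2 : y = q
      · subst h2
        simp only [h1, if_true, if_false, or_true]; split_ifs <;> omega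
      · simp only [h1, h2, or_self, if_false]; split_ifs <;> first | omega | (exfalso; tauto)
  have := sum_le_sum fun y (_ : y ∈ univ) => pt y
  simp only [sum_sub_distrib, sum_add_distrib, sum_ite_eq', mem_univ, if_true, sum_const,
    card_univ, nsmul_eq_mul, mul_one] at this
  linarith

theorem IsDeepRoot.exists_config (h : IsDeepRoot G S K r) (hs : IsFar G S r s)
    (hd : G.degree s = farMinDegree G r) :
    ∃ C, ¬ Solvable G r C ∧
      tMax G S K r s + phoenixIndicator G S r ≤ ∑ y, (C y : ℤ) + 1 := by
  unfold phoenixIndicator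
  split_ifs with hph
  · have hle := h.tMax_le_card_of_isPhoenix hd hph
    obtain ⟨⟨p, hp, q, hq, a, b, c, -, hab, hac, hbc, hNr, hNp, hNq, -⟩, -, -⟩ := hph
    have ar : ∀ y, G.Adj r y ↔ y = a ∨ y = b := fun y => by
      rw [← SimpleGraph.mem_neighborSet, hNr]; rfl
    have ap : ∀ y, G.Adj p y ↔ y = a ∨ y = c := fun y => by
      rw [← SimpleGraph.mem_neighborSet, hNp]; rfl
    have aq : ∀ y, G.Adj q y ↔ y = b ∨ y = c := fun y => by
      rw [← SimpleGraph.mem_neighborSet, hNq]; rfl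
    have hrp : r ≠ p := by
      rintro rfl
      rcases (ap b).1 ((ar b).2 (.inr rfl)) with e | e
      · exact hab e.symm
      · exact hbc e
    have hrq : r ≠ q := by
      rintro rfl
      rcases (aq a).1 ((ar a).2 (.inl rfl)) with e | e
      · exact hab e
      · exact hac e
    have hpq : p ≠ q := by
      rintro rfl
      rcases (aq a).1 ((ap a).2 (.inl rfl)) with e | e
      · exact hab e
      · exact hac e
    have haK : a ∈ K := h.split.mem_of_adj hp ((ap a).2 (.inl rfl))
    have hbK : b ∈ K := h.split.mem_of_adj hq ((aq b).2 (.inl rfl))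
    have hcK : c ∈ K := h.split.mem_of_adj hp ((ap c).2 (.inr rfl))
    refine ⟨phoenixConfig r p q a b c, phoenixConfig_not_solvable ?_ ar ap aq, ?_⟩
    · have := h.split.ne h.mem haK
      have := h.split.ne h.mem hbK
      have := h.split.ne h.mem hcK
      have := h.split.ne hp haK
      have := h.split.ne hp hbK
      have := h.split.ne hp hcK
      have := h.split.ne hq haK
      have := h.split.ne hq hbK
      have := h.split.ne hq hcK
      simp [*]
    · have := card_le_sum_phoenixConfig (r := r) (a := a) (b := b) (c := c) hpq
      linarith
  · simpa using h.exists_config_tMax hs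

end Lower

theorem SemigreedySolvable.solvable [DecidableEq V] {G : SimpleGraph V} {r : V} {C : V → ℕ}
    (h : SemigreedySolvable G r C) : Solvable G r C := by
  obtain ⟨D, hD, hr⟩ := h
  exact ⟨D, Relation.ReflTransGen.mono (fun _ _ ⟨u, v, h, _⟩ => ⟨u, v, h⟩) _ _ hD, hr⟩

theorem IsDeepRoot.pebblingNumber_eq [Fintype V] [DecidableEq V] {G : SimpleGraph V}
    [DecidableRel G.Adj] {S K : Set V} {r s : V} (h : IsDeepRoot G S K r) (hs : IsFar G S r s)
    (hd : G.degree s = farMinDegree G r) :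
    (pebblingNumber G r : ℤ) = tMax G S K r s + phoenixIndicator G S r := by
  have hup : ∀ C : V → ℕ, tMax G S K r s + phoenixIndicator G S r ≤ ∑ y, (C y : ℤ) →
      Solvable G r C := by
    intro C hC
    by_contra hn
    have := h.sum_lt_of_not_solvable hd fun hsg => hn (SemigreedySolvable.solvable hsg)
    omega
  obtain ⟨C, hC, hle⟩ := h.exists_config hs hd
  have heq : tMax G S K r s + phoenixIndicator G S r = ((∑ y, C y + 1 : ℕ) : ℤ) := by
    push_cast
    refine le_antisymm hle ?_
    by_contra! hlt
    exact hC (hup C (by omega))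
  rw [heq, Nat.cast_inj]
  refine le_antisymm (Nat.sInf_le fun D hD => hup D ?_) (le_csInf ⟨∑ y, C y + 1, fun D hD =>
    hup D ?_⟩ fun t ht => ?_)
  · rw [heq]; exact_mod_cast hD
  · rw [heq]; exact_mod_cast hD
  · by_contra! hlt
    exact hC (ht C (by omega))

end SplitPebbling

theorem mainTheorem2 {V : Type*} [Fintype V] [DecidableEq V] (G : SimpleGraph V)
    [DecidableRel G.Adj] (hG : G.Connected) (S K : Set V)
    (hSK : SplitPebbling.IsSplitPartition G S K) (r : V) (hr : r ∈ S) (hecc : G.eccent r = 3) :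
    SplitPebbling.IsSemigreedy G r ∧
      ∀ s : V, G.dist r s = 3 → G.degree s = SplitPebbling.farMinDegree G r →
        (SplitPebbling.pebblingNumber G r : ℤ) =
          SplitPebbling.tMax G S K r s + SplitPebbling.phoenixIndicator G S r := by
  have h : SplitPebbling.IsDeepRoot G S K r := ⟨hG, hSK, hr, hecc⟩
  refine ⟨fun C hC => ?_, fun s hs hd => h.pebblingNumber_eq (h.dist_eq_three_iff.1 hs) hd⟩
  by_contra hn
  obtain ⟨s, hs, hd⟩ := h.exists_degree_eq_farMinDegree
  have h1 := h.pebblingNumber_eq hs hd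
  have h2 := h.sum_lt_of_not_solvable hd hn
  have h3 : (SplitPebbling.pebblingNumber G r : ℤ) ≤ ∑ v, (C v : ℤ) := by exact_mod_cast hC
  omega
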